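/- All varieties are varieties of monoids, that is, nonempty classes of monoids closed under submonoids, homomorphic images and arbitrary direct products. A variety is \emph{finitely based} if it is defined by a finite set of identities, \emph{finitely generated} if it is generated by a finite monoid, and \emph{small} if it has only finitely many subvarieties; it is \emph{Cross} if it has all three properties. Let $\mathbf{A}_0$, $\mathbf{B}_0$, $\mathbf{E}$ and $\mathbf{Q}$ be the varieties generated by the following monoids with zero, respectively: \begin{align*} A_0 &= \langle e,f,1 \mid e^2=e,\ f^2=f,\ fe=0\rangle = \{0,e,f,ef,1\},\\ B_0 &= \langle a,e,f,1 \mid af=ea=a,\ e^2=e,\ f^2=f,\ ef=fe=0\rangle = \{0,a,e,f,1\},\\ E &= \langle a,e,1 \mid ae=a,\ ea=0,\ e^2=e\rangle = \{0,a,e,1\},\\ Q &= \langle a,b,e,1 \mid ae=ba=eb=0,\ be=b,\ ea=a,\ e^2=e\rangle = \{0,a,b,e,ab,1\}. \end{align*} Let $\overleftarrow{\mathbf{E}}$ be the dual of $\mathbf{E}$, consisting of the monoids obtained from those of $\mathbf{E}$ by reversing the multiplication; let $\mathbf{0}$ be the variety of trivial monoids; and for a word $w$ let $\mathbf{Rq}\{w\}$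 be the variety generated by the Rees quotient of the free monoid over a countably infinite alphabet by the ideal of all words that are not factors of $w$. Let $\mathbf{A}_0\vee\mathbf{Q}$ be the smallest variety containing both $\mathbf{A}_0$ and $\mathbf{Q}$. \textbf{Proposition.} The variety $\mathbf{A}_0\vee\mathbf{Q}$ is Cross. Moreover: (i) $\mathbf{A}_0\vee\mathbf{Q}$ is the variety defined by the identities \[ x^2hx\approx xhx,\quad xhx^2\approx xhx,\quad xyhxty\approx yxhxty,\quad xhytxy\approx xhytyx. \] (ii) The maximal subvarieties of $\mathbf{A}_0\vee\mathbf{Q}$ are exactly the two distinct varieties $\mathbf{A}_0$ and $\mathbf{Q}$. The variety $\mathbf{A}_0\vee\mathbf{Q}$ has exactly ten subvarieties, namely the pairwise distinct varieties \[ \mathbf{0},\ \mathbf{Rq}\{1\},\ \mathbf{Rq}\{x\},\ \mathbf{Rq}\{xy\},\ \mathbf{E},\ \overleftarrow{\mathbf{E}},\ \mathbf{B}_0,\ \mathbf{A}_0,\ \mathbf{Q},\ \mathbf{A}_0\vee\mathbf{Q}, \] and the inclusions among them are precisely those that follow, by reflexivity and transitivity, from \[ \mathbf{0}\subset\mathbf{Rq}\{1\}\subset\mathbf{Rq}\{x\}\subset\mathbf{Rq}\{xy\},\qquad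 \mathbf{Rq}\{xy\}\subset\mathbf{E}\subset\mathbf{B}_0,\qquad \mathbf{Rq}\{xy\}\subset\overleftarrow{\mathbf{E}}\subset\mathbf{B}_0, \] \[ \mathbf{B}_0\subset\mathbf{A}_0\subset\mathbf{A}_0\vee\mathbf{Q},\qquad \mathbf{B}_0\subset\mathbf{Q}\subset\mathbf{A}_0\vee\mathbf{Q}. \] -/

import Mathlib

universe u

/-! ## Words, identities and varieties of monoids -/

/-- A variety of monoids: a nonempty class of monoids closed under submonoids, homomorphic images
and arbitrary direct products. -/
structure MonoidVariety : Type (u + 1) where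
  /-- The class of all members of the variety. -/
  carrier : Set MonCat.{u}
  nonempty' : carrier.Nonempty
  sub_mem' : ∀ M ∈ carrier, ∀ S : Submonoid M, MonCat.of S ∈ carrier
  image_mem' : ∀ M ∈ carrier, ∀ (N : MonCat.{u}) (f : M →* N),
    Function.Surjective f → N ∈ carrier
  prod_mem' : ∀ (ι : Type u) (M : ι → MonCat.{u}), (∀ i, M i ∈ carrier) →
    MonCat.of (∀ i, M i) ∈ carrier

namespace MonoidVariety

instance : SetLike MonoidVariety.{u} MonCat.{u} where
  coe := carrier
  coe_injective V W h := by cases V; cases W; congr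

/-- Varieties are ordered by inclusion. -/
instance : PartialOrder MonoidVariety.{u} := PartialOrder.ofSetLike _ _

/-- The class of trivial monoids. -/
def trivial : MonoidVariety.{u} where
  carrier := {M | Subsingleton M}
  nonempty' := ⟨MonCat.of PUnit, (inferInstance : Subsingleton PUnit)⟩
  sub_mem' M hM S := by
    have : Subsingleton M := hM
    exact (inferInstance : Subsingleton S)
  image_mem' M hM N f hf := by
    have : Subsingleton M := hM
    exact hf.subsingleton
  prod_mem' ι M hM := by
    have : ∀ i, Subsingleton (M i) := hM
    exact (inferInstance : Subsingleton (∀ i, M i))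

/-- Every variety contains the one-element monoids. -/
theorem punit_mem (V : MonoidVariety.{u}) : MonCat.of PUnit.{u + 1} ∈ V := by
  obtain ⟨M, hM⟩ := V.nonempty'
  exact V.image_mem' M hM _ (1 : M →* PUnit) fun _ => ⟨1, rfl⟩

/-- The infimum of a set of varieties is their intersection. -/
instance : InfSet MonoidVariety.{u} where
  sInf s :=
    { carrier := {M | ∀ V ∈ s, M ∈ V}
      nonempty' := ⟨MonCat.of PUnit, fun V _ => V.punit_mem⟩
      sub_mem' := fun M hM S V hV => V.sub_mem' M (hM V hV) S
      image_mem' := fun M hM N f hf V hV => V.image_mem' M (hM V hV) N f hf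
      prod_mem' := fun ι M hM V hV => V.prod_mem' ι M fun i => hM i V hV }

/-- The complete lattice of all varieties of monoids. In particular, `V ⊔ W` is the smallest
variety that contains both `V` and `W`. -/
instance : CompleteLattice MonoidVariety.{u} :=
  completeLatticeOfInf _ fun _ =>
    ⟨fun _ hV _ hM => hM _ hV, fun _ hW _ hM _ hV => hW hV hM⟩

/-- The variety generated by a monoid: the smallest variety containing it. -/
def generatedBy (M : MonCat.{u}) : MonoidVariety.{u} := sInf {V | M ∈ V}

/-- The dual of a variety, consisting of the monoids whose opposite monoid is in the variety. -/
def dual (V : MonoidVariety.{u}) : MonoidVariety.{u} where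
  carrier := {M | MonCat.of (M : Type u)ᵐᵒᵖ ∈ V}
  nonempty' := ⟨MonCat.of PUnit,
    V.image_mem' _ V.punit_mem _ (1 : PUnit.{u + 1} →* (PUnit.{u + 1})ᵐᵒᵖ) fun _ => ⟨1, rfl⟩⟩
  sub_mem' M hM S := by
    refine V.image_mem' _ (V.sub_mem' _ hM (Submonoid.op S)) (MonCat.of (S : Type u)ᵐᵒᵖ)
      { toFun := fun x => MulOpposite.op ⟨MulOpposite.unop x.1, x.2⟩
        map_one' := rfl
        map_mul' := fun _ _ => rfl } ?_
    intro y
    exact ⟨⟨MulOpposite.op (MulOpposite.unop y).1, (MulOpposite.unop y).2⟩, rfl⟩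
  image_mem' M hM N f hf := by
    refine V.image_mem' _ hM (MonCat.of (N : Type u)ᵐᵒᵖ) (MonoidHom.op f) ?_
    intro y
    obtain ⟨x, hx⟩ := hf (MulOpposite.unop y)
    exact ⟨MulOpposite.op x, congrArg MulOpposite.op hx⟩
  prod_mem' ι M hM := by
    refine V.image_mem' _ (V.prod_mem' ι (fun i => MonCat.of (M i : Type u)ᵐᵒᵖ) hM)
      (MonCat.of (∀ i, M i)ᵐᵒᵖ)
      { toFun := fun x => MulOpposite.op fun i => MulOpposite.unop (x i)
        map_one' := rfl
        map_mul' := fun _ _ => rfl } ?_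
    intro y
    exact ⟨fun i => MulOpposite.op (MulOpposite.unop y i), rfl⟩

/-- Words over a countably infinite alphabet. -/
abbrev Word : Type := FreeMonoid ℕ

/-- An identity `u ≈ v`, given as the pair `(u, v)` of words. -/
abbrev Identity : Type := Word × Word

/-- The monoid `M` satisfies the identity `u ≈ v`: every substitution of elements of `M` for the
variables sends `u` and `v` to the same element. -/
def Satisfies (M : Type u) [Monoid M] (σ : Identity) : Prop :=
  ∀ φ : ℕ → M, FreeMonoid.lift φ σ.1 = FreeMonoid.lift φ σ.2

/-- The variety defined by a set of identities. -/
def definedBy (Sig : Set Identity) : MonoidVariety.{u} where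
  carrier := {M | ∀ σ ∈ Sig, Satisfies M σ}
  nonempty' := ⟨MonCat.of PUnit, fun _ _ _ => Subsingleton.elim (α := PUnit) _ _⟩
  sub_mem' M hM S σ hσ φ := by
    have key : ∀ w : Word, S.subtype (FreeMonoid.lift φ w) =
        FreeMonoid.lift (fun n => S.subtype (φ n)) w := fun w =>
      DFunLike.congr_fun (FreeMonoid.comp_lift S.subtype φ) w
    apply Subtype.val_injective
    exact (key _).trans ((hM σ hσ _).trans (key _).symm)
  image_mem' M hM N f hf σ hσ φ := by
    choose g hg using hf
    have key : ∀ w : Word, f (FreeMonoid.lift (fun n => g (φ n)) w) = FreeMonoid.lift φ w := by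
      intro w
      have h := DFunLike.congr_fun (FreeMonoid.comp_lift f (fun n => g (φ n))) w
      have h' : (f ∘ fun n => g (φ n)) = φ := funext fun n => hg (φ n)
      rw [h'] at h
      exact h
    rw [← key, ← key, hM σ hσ]
  prod_mem' ι M hM σ hσ φ := by
    funext i
    have key : ∀ w : Word, Pi.evalMonoidHom (fun i => (M i : Type u)) i (FreeMonoid.lift φ w) =
        FreeMonoid.lift (fun n => φ n i) w := fun w =>
      DFunLike.congr_fun
        (FreeMonoid.comp_lift (Pi.evalMonoidHom (fun i => (M i : Type u)) i) φ) w
    exact (key _).trans ((hM i σ hσ _).trans (key _).symm)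

/-- A variety is finitely based if it is defined by a finite set of identities. -/
def FinitelyBased (V : MonoidVariety.{u}) : Prop :=
  ∃ Sig : Set Identity, Sig.Finite ∧ V = definedBy Sig

/-- A variety is finitely generated if it is generated by a finite monoid. -/
def FinitelyGenerated (V : MonoidVariety.{u}) : Prop :=
  ∃ M : MonCat.{u}, Finite M ∧ V = generatedBy M

/-- A variety is small if it has only finitely many subvarieties. -/
def Small (V : MonoidVariety.{u}) : Prop := (Set.Iic V).Finite

/-- A Cross variety: finitely based, finitely generated and small. -/
def IsCross (V : MonoidVariety.{u}) : Prop :=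
  V.FinitelyBased ∧ V.FinitelyGenerated ∧ V.Small

/-! ## The finite monoids -/

/-- The elements of `A₀ = ⟨e, f, 1 ∣ e² = e, f² = f, fe = 0⟩`. -/
inductive MonA0 : Type
  | zero | e | f | ef | one
  deriving DecidableEq

instance : Monoid MonA0 where
  one := .one
  mul
    | .one, y => y
    | x, .one => x
    | .e, .e => .e
    | .e, .f => .ef
    | .e, .ef => .ef
    | .f, .f => .f
    | .ef, .f => .ef
    | _, _ => .zero
  mul_assoc x y z := by cases x <;> cases y <;> cases z <;> rfl
  one_mul x := by cases x <;> rfl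
  mul_one x := by cases x <;> rfl

/-- The elements of `B₀ = ⟨a, e, f, 1 ∣ af = ea = a, e² = e, f² = f, ef = fe = 0⟩`. -/
inductive MonB0 : Type
  | zero | a | e | f | one
  deriving DecidableEq

instance : Monoid MonB0 where
  one := .one
  mul
    | .one, y => y
    | x, .one => x
    | .a, .f => .a
    | .e, .a => .a
    | .e, .e => .e
    | .f, .f => .f
    | _, _ => .zero
  mul_assoc x y z := by cases x <;> cases y <;> cases z <;> rfl
  one_mul x := by cases x <;> rfl
  mul_one x := by cases x <;> rfl

/-- The elements of `E = ⟨a, e, 1 ∣ ae = a, ea = 0, e² = e⟩`. -/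
inductive MonE : Type
  | zero | a | e | one
  deriving DecidableEq

instance : Monoid MonE where
  one := .one
  mul
    | .one, y => y
    | x, .one => x
    | .a, .e => .a
    | .e, .e => .e
    | _, _ => .zero
  mul_assoc x y z := by cases x <;> cases y <;> cases z <;> rfl
  one_mul x := by cases x <;> rfl
  mul_one x := by cases x <;> rfl

/-- The elements of `Q = ⟨a, b, e, 1 ∣ ae = ba = eb = 0, be = b, ea = a, e² = e⟩`. -/
inductive MonQ : Type
  | zero | a | b | e | ab | one
  deriving DecidableEq

instance : Monoid MonQ where
  one := .one
  mul
    | .one, y => y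
    | x, .one => x
    | .a, .b => .ab
    | .b, .e => .b
    | .e, .a => .a
    | .e, .e => .e
    | .e, .ab => .ab
    | .ab, .e => .ab
    | _, _ => .zero
  mul_assoc x y z := by cases x <;> cases y <;> cases z <;> rfl
  one_mul x := by cases x <;> rfl
  mul_one x := by cases x <;> rfl

/-- The word `u` is a factor of some word in `W`. -/
def IsFactorOf (W : Set Word) (u : Word) : Prop := ∃ w ∈ W, ∃ p q : Word, w = p * u * q

/-- The Rees congruence on the free monoid over the ideal of all words that are not factors of
any word in `W`: this ideal is collapsed to one point. -/
def reesCon (W : Set Word) : Con Word where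
  r u v := u = v ∨ (¬ IsFactorOf W u ∧ ¬ IsFactorOf W v)
  iseqv :=
    { refl := fun _ => Or.inl rfl
      symm := by
        rintro u v (h | h)
        · exact Or.inl h.symm
        · exact Or.inr h.symm
      trans := by
        rintro u v w (rfl | h) (rfl | h')
        · exact Or.inl rfl
        · exact Or.inr h'
        · exact Or.inr h
        · exact Or.inr ⟨h.1, h'.2⟩ }
  mul' := by
    have left : ∀ u v : Word, IsFactorOf W (u * v) → IsFactorOf W u := by
      rintro u v ⟨w, hw, p, q, h⟩
      exact ⟨w, hw, p, v * q, by rw [h]; simp only [mul_assoc]⟩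
    have right : ∀ u v : Word, IsFactorOf W (u * v) → IsFactorOf W v := by
      rintro u v ⟨w, hw, p, q, h⟩
      exact ⟨w, hw, p * u, q, by rw [h]; simp only [mul_assoc]⟩
    rintro u u' v v' (rfl | h) (rfl | h')
    · exact Or.inl rfl
    · exact Or.inr ⟨fun k => h'.1 (right _ _ k), fun k => h'.2 (right _ _ k)⟩
    · exact Or.inr ⟨fun k => h.1 (left _ _ k), fun k => h.2 (left _ _ k)⟩
    · exact Or.inr ⟨fun k => h.1 (left _ _ k), fun k => h.2 (left _ _ k)⟩

/-- The Rees quotient `Rq W` of the free monoid. -/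
abbrev Rees (W : Set Word) : Type := (reesCon W).Quotient

/-! ## The varieties and the diagram of their lattice -/

/-- The variety generated by `A₀`. -/
def varA0 : MonoidVariety.{u} := generatedBy (MonCat.of (ULift.{u} MonA0))

/-- The variety generated by `B₀`. -/
def varB0 : MonoidVariety.{u} := generatedBy (MonCat.of (ULift.{u} MonB0))

/-- The variety generated by `E`. -/
def varE : MonoidVariety.{u} := generatedBy (MonCat.of (ULift.{u} MonE))

/-- The variety generated by `Q`. -/
def varQ : MonoidVariety.{u} := generatedBy (MonCat.of (ULift.{u} MonQ))

/-- The variety generated by `Rq W`. -/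
def varRees (W : Set Word) : MonoidVariety.{u} := generatedBy (MonCat.of (ULift.{u} (Rees W)))

/-- The variable `x`. -/
def x : Word := FreeMonoid.of 0
/-- The variable `y`. -/
def y : Word := FreeMonoid.of 1
/-- The variable `h`. -/
def h : Word := FreeMonoid.of 2
/-- The variable `t`. -/
def t : Word := FreeMonoid.of 3

/-- The identities `x²hx ≈ xhx`, `xhx² ≈ xhx`, `xyhxty ≈ yxhxty` and `xhytxy ≈ xhytyx`. -/
def basisA0Q : Set Identity :=
  {(x ^ 2 * h * x, x * h * x), (x * h * x ^ 2, x * h * x),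
    (x * y * h * x * t * y, y * x * h * x * t * y),
    (x * h * y * t * x * y, x * h * y * t * y * x)}

/-- The ten nodes of the diagram of the subvariety lattice. -/
inductive Node : Type
  | zero | rqOne | rqX | rqXY | e | eDual | b0 | a0 | q | a0q

/-- The variety at each node of the diagram. -/
def Node.variety : Node → MonoidVariety.{u}
  | .zero => trivial
  | .rqOne => varRees {1}
  | .rqX => varRees {x}
  | .rqXY => varRees {x * y}
  | .e => varE
  | .eDual => varE.dual
  | .b0 => varB0
  | .a0 => varA0
  | .q => varQ
  | .a0q => varA0 ⊔ varQ

/-- The edges of the diagram, directed upwards. -/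
inductive Node.Edge : Node → Node → Prop
  | zero_rqOne : Edge .zero .rqOne
  | rqOne_rqX : Edge .rqOne .rqX
  | rqX_rqXY : Edge .rqX .rqXY
  | rqXY_e : Edge .rqXY .e
  | rqXY_eDual : Edge .rqXY .eDual
  | e_b0 : Edge .e .b0
  | eDual_b0 : Edge .eDual .b0
  | b0_a0 : Edge .b0 .a0
  | b0_q : Edge .b0 .q
  | a0_a0q : Edge .a0 .a0q
  | q_a0q : Edge .q .a0q

end MonoidVariety

/-! By Birkhoff's theorem (`mem_iff_models`, `le_iff_eqv`) inclusions of varieties are reversed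
inclusions of their sets of identities, so the proposition reduces to word problems. The identities
of each generator are described by a combinatorial invariant, mostly formulated with linear letters,
the letters that occur once. For `Rq{1}` it is the set of letters; for `Rq{x}` also the set of
linear letters; for `Rq{xy}` also their order; for `E` and its dual the first, respectively last,
occurrences relative to linear letters; for `B₀` both; for `Q` also the content of the blocks
between linear letters; for `A₀` the subwords of length at most two. An identity of a generator
preserves its invariant because suitable elements of the generator detect it.

The converse rests on `eqv_of_invQ`. The basis lets adjacent letters commute when both occur again
on the same side, and lets a square contract when its letter occurs elsewhere. Two words are put
between fresh linear letters and replaced by equivalent words of minimal length. In such words a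
letter repeated within a block occurs nowhere else (`Minimal.not_mem`). This rigidity, together with
the invariants, allows the words to be matched letter by letter from the left (`eqv_of_minimal`). It
follows that the invariants of `Q` and `A₀` together characterise the identities of the basis, which
is therefore a basis of `A₀ ∨ Q`; the invariant of `Q` alone suffices under `xxyy ≈ xyxy`. The
smaller varieties reduce to these two cases through normal forms.

If a subvariety omits a generator, some identity of it violates that generator's invariant, and
substituting at the violation yields one specific identity: `x ≈ 1`, `x ≈ xx`, `xy ≈ yx`, `xyx ≈
yxx`, `xyx ≈ xxy`, `xxyy ≈ xyxy` and `xyxzx ≈ xyzx` for `Rq{1}`, `Rq{x}`, `Rq{xy}`, `E`, the dual of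
`E`, `A₀` and `Q`. These are the identities under which the completeness results apply, so a
subvariety is determined by which of the seven generators it contains (`exists_node`). -/

namespace MonoidVariety

/-! ### Equational logic of varieties and Birkhoff's theorem -/

/-- The monoid `M` satisfies the identity `u ≈ v`, with words as lists of letters. -/
def Models (M : Type*) [Monoid M] (u v : List ℕ) : Prop :=
  ∀ φ : ℕ → M, (u.map φ).prod = (v.map φ).prod

/-- The identity `u ≈ v` holds in the variety `V`. -/
def Eqv (V : MonoidVariety.{u}) (u v : List ℕ) : Prop := ∀ M ∈ V, Models M u v

theorem satisfies_iff {M : Type u} [Monoid M] (σ : Identity) :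
    Satisfies M σ ↔ Models M σ.1.toList σ.2.toList := by
  simp only [Satisfies, Models, FreeMonoid.lift_apply]

theorem mem_definedBy {S : Set Identity} {M : MonCat.{u}} :
    M ∈ definedBy S ↔ ∀ σ ∈ S, Models M σ.1.toList σ.2.toList :=
  forall₂_congr fun σ _ => satisfies_iff σ

theorem Models.of_surjective {M N : Type*} [Monoid M] [Monoid N] {u v : List ℕ}
    (h : Models M u v) (f : M →* N) (hf : Function.Surjective f) : Models N u v := by
  intro φ
  choose g hg using hf
  have key (w : List ℕ) : f ((w.map fun n => g (φ n)).prod) = (w.map φ).prod := by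
    rw [map_list_prod, List.map_map]
    exact congrArg (fun ψ => (w.map ψ).prod) (funext fun n => hg (φ n))
  rw [← key, ← key, h]

theorem models_congr {M N : Type*} [Monoid M] [Monoid N] (e : M ≃* N) {u v : List ℕ} :
    Models M u v ↔ Models N u v :=
  ⟨fun h => h.of_surjective e.toMonoidHom e.surjective,
    fun h => h.of_surjective e.symm.toMonoidHom e.symm.surjective⟩

theorem models_ulift {M : Type} [Monoid M] {u v : List ℕ} :
    Models (ULift.{u} M) u v ↔ Models M u v :=
  models_congr MulEquiv.ulift

/-- A set of letters of a list of elements can be renamed by natural numbers. -/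
theorem exists_rename {α : Type*} (l : List α) : ∃ (f : α → ℕ) (g : ℕ → Option α),
    ∀ a ∈ l, g (f a) = some a := by
  classical
  exact ⟨fun a => l.idxOf a, fun n => l[n]?, fun a ha => List.getElem?_idxOf ha⟩

/-- An identity of `V` in which the variables are from an arbitrary set. -/
theorem models_of_forall_eqv {V : MonoidVariety.{u}} {M : Type*} [Monoid M]
    (h : ∀ u v, V.Eqv u v → Models M u v) {α : Type*} (u v : List α)
    (huv : ∀ N ∈ V, ∀ φ : α → N, (u.map φ).prod = (v.map φ).prod) (φ : α → M) :
    (u.map φ).prod = (v.map φ).prod := by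
  obtain ⟨f, g, hg⟩ := exists_rename (u ++ v)
  have h1 := h (u.map f) (v.map f) fun N hN ψ => by
    simpa using huv N hN (ψ ∘ f)
  have h2 := h1 fun n => (g n).elim 1 φ
  simp only [List.map_map] at h2
  have key (w : List α) (hw : ∀ a ∈ w, a ∈ u ++ v) :
      w.map ((fun n => (g n).elim 1 φ) ∘ f) = w.map φ :=
    List.map_congr_left fun a ha => by simp [hg a (hw a ha)]
  rwa [key u (by simp +contextual), key v (by simp +contextual)] at h2

/-- Birkhoff's theorem: a monoid is in `V` if it satisfies the identities of `V`. -/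
theorem mem_iff_models {V : MonoidVariety.{u}} {M : MonCat.{u}} :
    M ∈ V ↔ ∀ u v, V.Eqv u v → Models M u v := by
  refine ⟨fun hM u v h => h M hM, fun h => ?_⟩
  -- One factor for each pair of words over the alphabet `M` that some member of `V` separates.
  -- There are few enough pairs for the product to stay in the universe of `M`.
  let I := {p : List M × List M //
    ∃ N ∈ V, ∃ φ : M → N, (p.1.map φ).prod ≠ (p.2.map φ).prod}
  have hI (i : I) : ∃ N : MonCat.{u}, N ∈ V ∧
      ∃ φ : M → N, (i.1.1.map φ).prod ≠ (i.1.2.map φ).prod := i.2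
  choose N hN φ hφ using hI
  let F : FreeMonoid (M : Type u) →* (∀ i, N i) := FreeMonoid.lift fun m i => φ i m
  have hF (w : FreeMonoid (M : Type u)) (i : I) : F w i = (w.toList.map (φ i)).prod := by
    have := DFunLike.congr_fun
      (FreeMonoid.comp_lift (Pi.evalMonoidHom (fun i => (N i : Type u)) i) fun m i => φ i m) w
    exact this.trans (FreeMonoid.lift_apply _ _)
  let G : FreeMonoid (M : Type u) →* M := FreeMonoid.lift id
  -- Words with equal image under `F` are separated by no member of `V`, hence form an identity of
  -- `V`, hence agree in `M`. So `M` is an image of the range of `F`, a submonoid of a product of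
  -- members of `V`.
  have hFG : Con.ker F.mrangeRestrict ≤ Con.ker G := by
    intro a b hab
    have hab' : F a = F b := congrArg Subtype.val hab
    have : (a.toList.map id).prod = (b.toList.map id).prod := by
      refine models_of_forall_eqv h a.toList b.toList (fun N' hN' ψ => ?_) id
      by_contra hne
      exact hφ ⟨(a.toList, b.toList), N', hN', ψ, hne⟩ (by rw [← hF, ← hF, hab'])
    show G a = G b
    simpa [G, FreeMonoid.lift_apply] using this
  refine V.image_mem' _ (V.sub_mem' _ (V.prod_mem' I N hN) (MonoidHom.mrange F)) M
    (((Con.ker F.mrangeRestrict).lift G hFG).comp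
      (Con.quotientKerEquivOfSurjective F.mrangeRestrict
        F.mrangeRestrict_surjective).symm.toMonoidHom) ?_
  intro m
  refine ⟨F.mrangeRestrict (FreeMonoid.of m), ?_⟩
  have : (Con.quotientKerEquivOfSurjective F.mrangeRestrict
      F.mrangeRestrict_surjective).symm (F.mrangeRestrict (FreeMonoid.of m)) =
      (FreeMonoid.of m : (Con.ker F.mrangeRestrict).Quotient) := by
    rw [MulEquiv.symm_apply_eq]; rfl
  simp only [MonoidHom.comp_apply]
  erw [this]
  simp [G]

theorem le_iff_eqv {V U : MonoidVariety.{u}} :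
    V ≤ U ↔ ∀ u v, U.Eqv u v → V.Eqv u v :=
  ⟨fun h _ _ huv M hM => huv M (h hM),
    fun h _ hM => mem_iff_models.2 fun u v huv => h u v huv _ hM⟩

theorem generatedBy_le {M : MonCat.{u}} {V : MonoidVariety.{u}} :
    generatedBy M ≤ V ↔ M ∈ V :=
  ⟨fun h => h fun _ hU => hU, fun h => sInf_le h⟩

/-- The monoids that satisfy a given identity form a variety. -/
def single (u v : List ℕ) : MonoidVariety.{u} :=
  definedBy {(FreeMonoid.ofList u, FreeMonoid.ofList v)}

theorem mem_single {u v : List ℕ} {M : MonCat.{u}} : M ∈ single u v ↔ Models M u v := by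
  simp [single, mem_definedBy]

theorem le_single {V : MonoidVariety.{u}} {u v : List ℕ} : V ≤ single u v ↔ V.Eqv u v :=
  forall₂_congr fun _ _ => mem_single

theorem eqv_generatedBy {M : MonCat.{u}} {u v : List ℕ} :
    (generatedBy M).Eqv u v ↔ Models M u v := by
  rw [← le_single, generatedBy_le, mem_single]

theorem eqv_sup {V U : MonoidVariety.{u}} {u v : List ℕ} :
    (V ⊔ U).Eqv u v ↔ V.Eqv u v ∧ U.Eqv u v := by
  simp only [← le_single, sup_le_iff]

namespace Eqv

variable {V : MonoidVariety.{u}} {u v w u' v' : List ℕ}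

theorem refl (V : MonoidVariety.{u}) (u : List ℕ) : V.Eqv u u := fun _ _ _ => rfl

theorem symm (h : V.Eqv u v) : V.Eqv v u := fun M hM φ => (h M hM φ).symm

theorem trans (h : V.Eqv u v) (h' : V.Eqv v w) : V.Eqv u w :=
  fun M hM φ => (h M hM φ).trans (h' M hM φ)

theorem append (h : V.Eqv u v) (h' : V.Eqv u' v') : V.Eqv (u ++ u') (v ++ v') :=
  fun M hM φ => by simp [h M hM φ, h' M hM φ]

theorem append_left (p : List ℕ) (h : V.Eqv u v) : V.Eqv (p ++ u) (p ++ v) := (refl V p).append h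

theorem append_right (h : V.Eqv u v) (q : List ℕ) : V.Eqv (u ++ q) (v ++ q) := h.append (refl V q)

theorem cons (a : ℕ) (h : V.Eqv u v) : V.Eqv (a :: u) (a :: v) := h.append_left [a]

end Eqv

/-! ## Duality -/

theorem models_op {M : Type*} [Monoid M] {u v : List ℕ} :
    Models Mᵐᵒᵖ u v ↔ Models M u.reverse v.reverse := by
  have key (φ : ℕ → M) (w : List ℕ) :
      (w.map fun n => MulOpposite.op (φ n)).prod = MulOpposite.op ((w.reverse.map φ).prod) := by
    induction w with
    | nil => simp
    | cons a w ih => simp [ih]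
  constructor
  · intro h φ
    have := h fun n => MulOpposite.op (φ n)
    rw [key, key] at this
    exact MulOpposite.op_injective this
  · intro h φ
    have := h fun n => MulOpposite.unop (φ n)
    have h2 := key (fun n => MulOpposite.unop (φ n))
    simp only [MulOpposite.op_unop] at h2
    rw [h2, h2, this]

theorem op_op_mem {V : MonoidVariety.{u}} {M : MonCat.{u}} :
    MonCat.of (M : Type u)ᵐᵒᵖᵐᵒᵖ ∈ V ↔ M ∈ V := by
  simp only [mem_iff_models]
  refine forall₃_congr fun u v _ => ?_
  show Models (M : Type u)ᵐᵒᵖᵐᵒᵖ u v ↔ _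
  simp [models_op]

theorem dual_dual (V : MonoidVariety.{u}) : V.dual.dual = V :=
  SetLike.ext fun _ => op_op_mem

theorem dual_le_dual {V U : MonoidVariety.{u}} (h : V ≤ U) : V.dual ≤ U.dual :=
  fun _ hM => h hM

theorem eqv_dual {V : MonoidVariety.{u}} {u v : List ℕ} :
    V.dual.Eqv u v ↔ V.Eqv u.reverse v.reverse := by
  have key (V : MonoidVariety.{u}) (u v : List ℕ) (h : V.Eqv u.reverse v.reverse) :
      V.dual.Eqv u v := fun M hM => by
    have := h _ hM
    rw [← models_op] at this
    exact this.of_surjective (MulEquiv.opOp M).symm.toMonoidHom (MulEquiv.opOp M).symm.surjective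
  refine ⟨fun h => ?_, key V u v⟩
  have := key V.dual u.reverse v.reverse (by simpa using h)
  rwa [dual_dual] at this

/-! ## Subwords -/

theorem pair_sublist_append {x y : ℕ} {l r : List ℕ} : [x, y].Sublist (l ++ r) ↔
    [x, y].Sublist l ∨ (x ∈ l ∧ y ∈ r) ∨ [x, y].Sublist r := by
  constructor
  · intro h
    obtain ⟨a, b, hab, ha, hb⟩ := List.sublist_append_iff.1 h
    match a, hab with
    | [], hab => simp at hab; subst hab; exact Or.inr (Or.inr hb)
    | [_], hab => simp at hab; obtain ⟨rfl, rfl⟩ := hab; simp at ha hb; exact Or.inr (Or.inl ⟨ha, hb⟩)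
    | [_, _], hab => simp at hab; obtain ⟨rfl, rfl, rfl⟩ := hab; exact Or.inl ha
    | _ :: _ :: _ :: _, hab => simp at hab
  · rintro (h | ⟨h, h'⟩ | h)
    · exact h.trans (List.sublist_append_left _ _)
    · exact (List.singleton_sublist.2 h).append (List.singleton_sublist.2 h')
    · exact h.trans (List.sublist_append_right _ _)

theorem triple_sublist_append {x y z : ℕ} {l r : List ℕ} : [x, y, z].Sublist (l ++ r) ↔
    [x, y, z].Sublist l ∨ ([x, y].Sublist l ∧ z ∈ r) ∨ (x ∈ l ∧ [y, z].Sublist r) ∨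
      [x, y, z].Sublist r := by
  constructor
  · intro h
    obtain ⟨a, b, hab, ha, hb⟩ := List.sublist_append_iff.1 h
    match a, hab with
    | [], hab => simp at hab; subst hab; tauto
    | [_], hab => simp at hab; obtain ⟨rfl, rfl⟩ := hab; simp at ha; tauto
    | [_, _], hab => simp at hab; obtain ⟨rfl, rfl, rfl⟩ := hab; simp at hb; tauto
    | [_, _, _], hab => simp at hab; obtain ⟨rfl, rfl, rfl, rfl⟩ := hab; tauto
    | _ :: _ :: _ :: _ :: _, hab => simp at hab
  · rintro (h | ⟨h, h'⟩ | ⟨h, h'⟩ | h)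
    · exact h.trans (List.sublist_append_left _ _)
    · exact h.append (List.singleton_sublist.2 h')
    · exact (List.singleton_sublist.2 h).append h'
    · exact h.trans (List.sublist_append_right _ _)

theorem pair_sublist_cons {x y a : ℕ} {l : List ℕ} : [x, y].Sublist (a :: l) ↔
    (x = a ∧ y ∈ l) ∨ [x, y].Sublist l := by
  have := @pair_sublist_append x y [a] l
  simpa using this

theorem triple_sublist_cons {x y z a : ℕ} {l : List ℕ} : [x, y, z].Sublist (a :: l) ↔
    (x = a ∧ [y, z].Sublist l) ∨ [x, y, z].Sublist l := by
  have := @triple_sublist_append x y z [a] l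
  simpa using this

theorem mem_left_of_pair {x y : ℕ} {l : List ℕ} (h : [x, y].Sublist l) : x ∈ l :=
  h.subset (by simp)

theorem mem_right_of_pair {x y : ℕ} {l : List ℕ} (h : [x, y].Sublist l) : y ∈ l :=
  h.subset (by simp)

theorem pair_self_sublist {x : ℕ} {l : List ℕ} : [x, x].Sublist l ↔ 2 ≤ l.count x :=
  (List.replicate_sublist_iff (n := 2)).trans Iff.rfl

/-- A letter of a word is linear if it occurs only once. -/
def Lin (w : List ℕ) (x : ℕ) : Prop := w.count x = 1

theorem lin_iff {w : List ℕ} {x : ℕ} : Lin w x ↔ x ∈ w ∧ ¬ [x, x].Sublist w := by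
  rw [pair_self_sublist, ← List.one_le_count_iff, Lin]; omega

theorem Lin.mem {w : List ℕ} {x : ℕ} (h : Lin w x) : x ∈ w := (lin_iff.1 h).1

theorem lin_split {p q : List ℕ} {x : ℕ} : Lin (p ++ x :: q) x ↔ x ∉ p ∧ x ∉ q := by
  simp [lin_iff, pair_sublist_append]
  grind [mem_left_of_pair]

theorem not_lin_split {p q : List ℕ} {x : ℕ} : ¬ Lin (p ++ x :: q) x ↔ x ∈ p ∨ x ∈ q := by
  rw [lin_split]; tauto

theorem Lin.exists_split {w : List ℕ} {s : ℕ} (h : Lin w s) :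
    ∃ p q, w = p ++ s :: q ∧ s ∉ p ∧ s ∉ q := by
  obtain ⟨p, q, rfl⟩ := List.append_of_mem h.mem
  exact ⟨p, q, rfl, lin_split.1 h⟩

theorem before_lin {p q : List ℕ} {x s : ℕ} (h : s ∉ p) (h' : s ∉ q) :
    [x, s].Sublist (p ++ s :: q) ↔ x ∈ p := by
  rw [pair_sublist_append, pair_sublist_cons]
  grind [mem_right_of_pair]

theorem after_lin {p q : List ℕ} {x s : ℕ} (h : s ∉ p) (h' : s ∉ q) :
    [s, x].Sublist (p ++ s :: q) ↔ x ∈ q := by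
  rw [pair_sublist_append, pair_sublist_cons]
  grind [mem_left_of_pair]

theorem between_lin {p q r : List ℕ} {x s t : ℕ} (hs : Lin (p ++ s :: (q ++ t :: r)) s)
    (ht : Lin (p ++ s :: (q ++ t :: r)) t) :
    [s, x, t].Sublist (p ++ s :: (q ++ t :: r)) ↔ x ∈ q := by
  rw [lin_split] at hs
  have ht' : t ∉ p ++ s :: q ∧ t ∉ r := by rw [← lin_split]; simpa using ht
  simp only [triple_sublist_append, triple_sublist_cons, pair_sublist_append, pair_sublist_cons]
  have a1 : ∀ l : List ℕ, [s, x, t].Sublist l → s ∈ l := fun l h => h.subset (by simp)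
  have a2 : ∀ l : List ℕ, [s, x, t].Sublist l → t ∈ l := fun l h => h.subset (by simp)
  grind [mem_left_of_pair, mem_right_of_pair]

/-! ## Invariants of identities -/

/-- The words have the same letters and the same linear letters. -/
structure InvRqX (u v : List ℕ) : Prop where
  mem : ∀ x, x ∈ u ↔ x ∈ v
  lin : ∀ x, Lin u x ↔ Lin v x

/-- The linear letters appear in the same order. -/
structure InvRqXY (u v : List ℕ) : Prop extends InvRqX u v where
  order : ∀ s t, Lin u s → Lin u t → ([s, t].Sublist u ↔ [s, t].Sublist v)

/-- The first occurrences are in the same position with respect to the linear letters. -/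
structure InvE (u v : List ℕ) : Prop extends InvRqX u v where
  before : ∀ x s, Lin u s → ([x, s].Sublist u ↔ [x, s].Sublist v)

/-- The last occurrences are in the same position with respect to the linear letters. -/
structure InvEDual (u v : List ℕ) : Prop extends InvRqX u v where
  after : ∀ x s, Lin u s → ([s, x].Sublist u ↔ [s, x].Sublist v)

/-- The first and last occurrences are in the same position with respect to the linear letters. -/
structure InvB0 (u v : List ℕ) : Prop extends InvE u v, InvEDual u v

/-- All occurrences are in the same blocks between linear letters. -/
structure InvQ (u v : List ℕ) : Prop extends InvB0 u v where
  between : ∀ s x t, Lin u s → Lin u t → ([s, x, t].Sublist u ↔ [s, x, t].Sublist v)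

/-- The words have the same subwords of length at most two. -/
structure InvA0 (u v : List ℕ) : Prop where
  mem : ∀ x, x ∈ u ↔ x ∈ v
  pair : ∀ x y, [x, y].Sublist u ↔ [x, y].Sublist v

theorem InvRqX.symm {u v : List ℕ} (h : InvRqX u v) : InvRqX v u :=
  ⟨fun x => (h.mem x).symm, fun x => (h.lin x).symm⟩

theorem InvE.symm {u v : List ℕ} (h : InvE u v) : InvE v u :=
  ⟨h.toInvRqX.symm, fun x s hs => (h.before x s ((h.lin s).2 hs)).symm⟩

theorem InvEDual.symm {u v : List ℕ} (h : InvEDual u v) : InvEDual v u :=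
  ⟨h.toInvRqX.symm, fun x s hs => (h.after x s ((h.lin s).2 hs)).symm⟩

theorem InvB0.symm {u v : List ℕ} (h : InvB0 u v) : InvB0 v u :=
  ⟨h.toInvE.symm, h.toInvEDual.symm.after⟩

theorem InvQ.symm {u v : List ℕ} (h : InvQ u v) : InvQ v u :=
  ⟨h.toInvB0.symm, fun s x t hs ht => (h.between s x t ((h.lin s).2 hs) ((h.lin t).2 ht)).symm⟩

theorem InvA0.symm {u v : List ℕ} (h : InvA0 u v) : InvA0 v u :=
  ⟨fun x => (h.mem x).symm, fun x y => (h.pair x y).symm⟩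

theorem InvRqX.trans {u v w : List ℕ} (h : InvRqX u v) (h' : InvRqX v w) : InvRqX u w :=
  ⟨fun x => (h.mem x).trans (h'.mem x), fun x => (h.lin x).trans (h'.lin x)⟩

theorem InvRqXY.trans {u v w : List ℕ} (h : InvRqXY u v) (h' : InvRqXY v w) : InvRqXY u w :=
  ⟨h.toInvRqX.trans h'.toInvRqX, fun s t hs ht =>
    (h.order s t hs ht).trans (h'.order s t ((h.lin s).1 hs) ((h.lin t).1 ht))⟩

theorem InvE.trans {u v w : List ℕ} (h : InvE u v) (h' : InvE v w) : InvE u w :=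
  ⟨h.toInvRqX.trans h'.toInvRqX, fun x s hs =>
    (h.before x s hs).trans (h'.before x s ((h.lin s).1 hs))⟩

theorem InvEDual.trans {u v w : List ℕ} (h : InvEDual u v) (h' : InvEDual v w) : InvEDual u w :=
  ⟨h.toInvRqX.trans h'.toInvRqX, fun x s hs =>
    (h.after x s hs).trans (h'.after x s ((h.lin s).1 hs))⟩

theorem InvB0.trans {u v w : List ℕ} (h : InvB0 u v) (h' : InvB0 v w) : InvB0 u w :=
  ⟨h.toInvE.trans h'.toInvE, (h.toInvEDual.trans h'.toInvEDual).after⟩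

theorem InvQ.trans {u v w : List ℕ} (h : InvQ u v) (h' : InvQ v w) : InvQ u w :=
  ⟨h.toInvB0.trans h'.toInvB0, fun s x t hs ht =>
    (h.between s x t hs ht).trans (h'.between s x t ((h.lin s).1 hs) ((h.lin t).1 ht))⟩

theorem InvA0.trans {u v w : List ℕ} (h : InvA0 u v) (h' : InvA0 v w) : InvA0 u w :=
  ⟨fun x => (h.mem x).trans (h'.mem x), fun x y => (h.pair x y).trans (h'.pair x y)⟩

theorem InvA0.toInvB0 {u v : List ℕ} (h : InvA0 u v) : InvB0 u v where
  mem := h.mem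
  lin x := by rw [lin_iff, lin_iff, h.mem, h.pair]
  before x s _ := h.pair x s
  after x s _ := h.pair s x

theorem InvE.toInvRqXY {u v : List ℕ} (h : InvE u v) : InvRqXY u v :=
  ⟨h.toInvRqX, fun s t _ ht => h.before s t ht⟩

theorem InvEDual.toInvRqXY {u v : List ℕ} (h : InvEDual u v) : InvRqXY u v :=
  ⟨h.toInvRqX, fun s t hs _ => h.after t s hs⟩

/-! ## The variety defined by the basis -/

theorem mem_basis {M : MonCat.{u}} : M ∈ definedBy basisA0Q ↔
    (∀ a h : M, a * a * h * a = a * h * a) ∧ (∀ a h : M, a * h * a * a = a * h * a) ∧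
    (∀ a b h t : M, a * b * h * a * t * b = b * a * h * a * t * b) ∧
    (∀ a b h t : M, a * h * b * t * a * b = a * h * b * t * b * a) := by
  have e1 : (x ^ 2 * h * x).toList = [0, 0, 2, 0] := rfl
  have e2 : (x * h * x).toList = [0, 2, 0] := rfl
  have e3 : (x * h * x ^ 2).toList = [0, 2, 0, 0] := rfl
  have e4 : (x * y * h * x * t * y).toList = [0, 1, 2, 0, 3, 1] := rfl
  have e5 : (y * x * h * x * t * y).toList = [1, 0, 2, 0, 3, 1] := rfl
  have e6 : (x * h * y * t * x * y).toList = [0, 2, 1, 3, 0, 1] := rfl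
  have e7 : (x * h * y * t * y * x).toList = [0, 2, 1, 3, 1, 0] := rfl
  simp only [mem_definedBy, basisA0Q, Set.mem_insert_iff, Set.mem_singleton_iff, forall_eq_or_imp,
    forall_eq, e1, e2, e3, e4, e5, e6, e7, Models, List.map_cons, List.map_nil, List.prod_cons,
    List.prod_nil, mul_one, ← mul_assoc]
  refine and_congr ⟨fun H a h => ?_, fun H φ => H _ _⟩ (and_congr ⟨fun H a h => ?_, fun H φ => H _ _⟩
    (and_congr ⟨fun H a b h t => ?_, fun H φ => H _ _ _ _⟩ ⟨fun H a b h t => ?_, fun H φ => H _ _ _ _⟩))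
  · exact H fun n => if n = 0 then a else h
  · exact H fun n => if n = 0 then a else h
  · exact H fun n => if n = 0 then a else if n = 1 then b else if n = 2 then h else t
  · exact H fun n => if n = 0 then a else if n = 1 then b else if n = 2 then h else t

/-! ### Rewriting with the basis, and words of minimal length -/

section Rewriting

variable {V : MonoidVariety.{u}} {p q l : List ℕ} {x z : ℕ}

/-- This is `xyhxty ≈ yxhxty`; the two possible orders of the later occurrences correspond to
exchanging the roles of the variables. -/
theorem swap_of_mem_right (hV : V ≤ definedBy basisA0Q) (hz : z ∈ q) (hx : x ∈ q) :
    V.Eqv (p ++ z :: x :: q) (p ++ x :: z :: q) := by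
  refine Eqv.append_left p fun M hM φ => ?_
  obtain ⟨-, -, h3, -⟩ := mem_basis.1 (hV hM)
  obtain ⟨a, b, rfl⟩ := List.append_of_mem hz
  rcases eq_or_ne x z with rfl | hne
  · rfl
  simp only [List.mem_append, List.mem_cons, hne, false_or] at hx
  rcases hx with hx | hx
  · obtain ⟨c, d, rfl⟩ := List.append_of_mem hx
    have := h3 (φ x) (φ z) (c.map φ).prod (d.map φ).prod
    simp only [List.map_append, List.map_cons, List.prod_append, List.prod_cons, ← mul_assoc] at this ⊢
    rw [this]
  · obtain ⟨c, d, rfl⟩ := List.append_of_mem hx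
    have := h3 (φ z) (φ x) (a.map φ).prod (c.map φ).prod
    simp only [List.map_append, List.map_cons, List.prod_append, List.prod_cons, ← mul_assoc] at this ⊢
    rw [this]

theorem swap_of_mem_left (hV : V ≤ definedBy basisA0Q) (hz : z ∈ p) (hx : x ∈ p) :
    V.Eqv (p ++ z :: x :: q) (p ++ x :: z :: q) := by
  rw [show p ++ z :: x :: q = (p ++ [z, x]) ++ q by simp,
    show p ++ x :: z :: q = (p ++ [x, z]) ++ q by simp]
  refine Eqv.append_right (fun M hM φ => ?_) q
  obtain ⟨-, -, -, h4⟩ := mem_basis.1 (hV hM)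
  obtain ⟨a, b, rfl⟩ := List.append_of_mem hz
  rcases eq_or_ne x z with rfl | hne
  · rfl
  simp only [List.mem_append, List.mem_cons, hne, false_or] at hx
  rcases hx with hx | hx
  · obtain ⟨c, d, rfl⟩ := List.append_of_mem hx
    have := h4 (φ x) (φ z) (d.map φ).prod (b.map φ).prod
    simp only [List.map_append, List.map_cons, List.map_nil, List.prod_append, List.prod_cons,
      List.prod_nil, mul_one, mul_assoc] at this ⊢
    rw [this]
  · obtain ⟨c, d, rfl⟩ := List.append_of_mem hx
    have := h4 (φ z) (φ x) (c.map φ).prod (d.map φ).prod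
    simp only [List.map_append, List.map_cons, List.map_nil, List.prod_append, List.prod_cons,
      List.prod_nil, mul_one, mul_assoc] at this ⊢
    rw [this]

theorem contract (hV : V ≤ definedBy basisA0Q) (h : x ∈ p ∨ x ∈ q) :
    V.Eqv (p ++ x :: x :: q) (p ++ x :: q) := by
  rcases h with h | h
  · obtain ⟨a, b, rfl⟩ := List.append_of_mem h
    intro M hM φ
    have := (mem_basis.1 (hV hM)).2.1 (φ x) (b.map φ).prod
    simp only [mul_assoc] at this
    simp only [List.map_append, List.map_cons, List.prod_append, List.prod_cons, mul_assoc]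
    rw [← mul_assoc (φ x) (φ x), ← mul_assoc _ (φ x * φ x), ← mul_assoc (φ x), this]
    simp only [mul_assoc]
  · obtain ⟨a, b, rfl⟩ := List.append_of_mem h
    refine Eqv.append_left p fun M hM φ => ?_
    have := (mem_basis.1 (hV hM)).1 (φ x) (a.map φ).prod
    simp only [List.map_append, List.map_cons, List.prod_append, List.prod_cons, ← mul_assoc] at this ⊢
    rw [this]

theorem move_left
    (h : ∀ a z b, l = a ++ z :: b → V.Eqv (p ++ a ++ z :: x :: (b ++ q)) (p ++ a ++ x :: z :: (b ++ q))) :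
    V.Eqv (p ++ (l ++ x :: q)) (p ++ x :: (l ++ q)) := by
  induction l generalizing p with
  | nil => exact Eqv.refl _ _
  | cons z l ih =>
    have h1 := @ih (p ++ [z]) fun a z' b hab => by
      have := h (z :: a) z' b (by simp [hab])
      simpa using this
    have h2 := h [] z l rfl
    simp only [List.append_assoc, List.singleton_append, List.append_nil] at h1 h2
    exact h1.trans h2

/-- Every letter of `l` has another occurrence on one of the two sides, and `x` is available on
both, so one of the two swaps always applies. -/
theorem move_left_of_mem (hV : V ≤ definedBy basisA0Q) (hp : x ∈ p) (hq : x ∈ q)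
    (hl : ∀ z ∈ l, ¬ Lin (p ++ (l ++ x :: q)) z) :
    V.Eqv (p ++ (l ++ x :: q)) (p ++ x :: (l ++ q)) := by
  refine move_left fun a z b hab => ?_
  have h1 := hl z (by simp [hab])
  rw [hab, show p ++ (a ++ z :: b ++ x :: q) = (p ++ a) ++ z :: (b ++ x :: q) by simp,
    not_lin_split] at h1
  rcases h1 with h1 | h1
  · exact swap_of_mem_left hV h1 (by simp [hp])
  · rcases eq_or_ne z x with rfl | hne
    · exact Eqv.refl _ _
    · exact swap_of_mem_right hV (by simpa [hne] using h1) (by simp [hq])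

/-- A word of minimal length among those that are equal to it in `V`. -/
def Minimal (V : MonoidVariety.{u}) (w : List ℕ) : Prop := ∀ w', V.Eqv w w' → w.length ≤ w'.length

theorem exists_minimal (V : MonoidVariety.{u}) (w : List ℕ) : ∃ w', V.Eqv w w' ∧ V.Minimal w' := by
  obtain ⟨w', hw', hmin⟩ := (measure List.length).wf.has_min {w' | V.Eqv w w'} ⟨w, Eqv.refl V w⟩
  exact ⟨w', hw', fun w'' h => not_lt.1 (hmin w'' (hw'.trans h))⟩

theorem Minimal.of_eqv {w w' : List ℕ} (h : V.Minimal w) (h' : V.Eqv w w')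
    (hlen : w'.length = w.length) : V.Minimal w' := fun w'' h'' => hlen ▸ h w'' (h'.trans h'')

/-- In a word of minimal length, a letter that occurs twice in a block does not occur elsewhere. -/
theorem Minimal.not_mem {a b c : List ℕ} (hV : V ≤ definedBy basisA0Q)
    (h : V.Minimal (a ++ x :: (b ++ x :: c)))
    (hb : ∀ z ∈ b, ¬ Lin (a ++ x :: (b ++ x :: c)) z) : x ∉ a ∧ x ∉ b ∧ x ∉ c := by
  -- In each of the three cases a further occurrence of `x` makes it possible to bring two
  -- occurrences together and contract them, contradicting minimality.
  have ha : x ∉ a := fun ha => by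
    have h1 := move_left_of_mem (p := a) (q := x :: c) (l := b) hV ha (by simp)
    have h2 := h _ ((h1 ?_).symm.trans ?_ : V.Eqv _ (a ++ (b ++ x :: c)))
    · simp at h2
    · intro z hz hlin
      refine hb z hz ?_
      rcases eq_or_ne x z with rfl | hne
      · exact absurd hlin (by rw [← List.append_assoc, not_lin_split]; simp [ha])
      · simpa [Lin, List.count_cons, hne] using hlin
    · rw [← List.append_assoc, ← List.append_assoc]
      exact contract hV (by simp [ha])
  have hc : x ∉ c := fun hc => by
    have h1 := move_left_of_mem (p := a ++ [x]) (q := c) (l := b) hV (by simp) hc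
    simp only [List.append_assoc, List.singleton_append] at h1
    have h2 := h _ ((h1 hb).trans (contract hV (by simp [hc])))
    simp at h2
  refine ⟨ha, fun hxb => ?_, hc⟩
  obtain ⟨b₁, b₂, rfl⟩ := List.append_of_mem hxb
  have h1 := move_left_of_mem (p := a ++ [x]) (q := b₂ ++ x :: c) (l := b₁) hV (x := x) (by simp) (by simp)
  simp only [List.append_assoc, List.cons_append] at h1 h hb
  have h2 := h _ ((h1 fun z hz => hb z (by simp [hz])).trans (contract hV (by simp)))
  simp at h2

end Rewriting

theorem exists_last_split {P : ℕ → Prop} {l : List ℕ} (h : ∃ s ∈ l, P s) :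
    ∃ a s b, l = a ++ s :: b ∧ P s ∧ ∀ z ∈ b, ¬ P z := by
  induction l with
  | nil => simp at h
  | cons c l ih =>
    by_cases hl : ∃ s ∈ l, P s
    · obtain ⟨a, s, b, rfl, hs, hb⟩ := ih hl
      exact ⟨c :: a, s, b, rfl, hs, hb⟩
    · refine ⟨[], c, l, rfl, ?_, fun z hz hPz => hl ⟨z, hz, hPz⟩⟩
      obtain ⟨s, hs, hPs⟩ := h
      rcases List.mem_cons.1 hs with rfl | hs
      · exact hPs
      · exact absurd ⟨s, hs, hPs⟩ hl

theorem exists_first_split {P : ℕ → Prop} {l : List ℕ} (h : ∃ s ∈ l, P s) :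
    ∃ a s b, l = a ++ s :: b ∧ P s ∧ ∀ z ∈ a, ¬ P z := by
  obtain ⟨a, s, b, hl, hs, hb⟩ := exists_last_split (P := P) (l := l.reverse) (by simpa using h)
  exact ⟨b.reverse, s, a.reverse, by simpa using congrArg List.reverse hl, hs, by simpa using hb⟩

theorem exists_split_of_mem {l : List ℕ} {x : ℕ} (h : x ∈ l) : ∃ a b, l = a ++ x :: b ∧ x ∉ a := by
  obtain ⟨a, s, b, rfl, rfl, ha⟩ := exists_first_split (P := (· = x)) ⟨x, h, rfl⟩
  exact ⟨a, b, rfl, fun hx => ha _ hx rfl⟩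

/-! ### Matching words of minimal length from the left -/

section Engine

variable {V : MonoidVariety.{u}} {p u v u₁ u₂ : List ℕ} {x : ℕ}

/-- Suppose `u` starts with another letter `y`. Then `y` precedes `x`, so it lies in `p`, and the
block invariant puts it in the last block of `p`. Now `y` is repeated within one block of a minimal
word, so it occurs nowhere else. Being nonlinear, it would have to occur after `x` in `v`, hence
also in `u`. -/
theorem eq_cons_of_lin (hV : V ≤ definedBy basisA0Q) (hmin : V.Minimal (p ++ u))
    (hinv : InvQ (p ++ u) (p ++ x :: v)) (hx : Lin (p ++ x :: v) x)
    (hp : ∃ s ∈ p, Lin (p ++ u) s) : ∃ u', u = x :: u' := by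
  obtain ⟨p₀, s, p₁, rfl, hs, hp₁⟩ := exists_last_split hp
  have hxu := (hinv.lin x).2 hx
  have hxp := lin_split.1 hx
  obtain ⟨u₁, u₂, rfl⟩ := List.append_of_mem
    ((List.mem_append.1 hxu.mem).resolve_left hxp.1)
  have hxu' : x ∉ p₀ ++ s :: p₁ ++ u₁ ∧ x ∉ u₂ := by
    rw [← lin_split]; simpa using hxu
  rcases u₁ with _ | ⟨y, u₁⟩
  · exact ⟨u₂, rfl⟩
  exfalso
  have hyx : y ∈ p₀ ++ s :: p₁ := by
    rw [← before_lin hxp.1 hxp.2, ← hinv.before y x hxu, ← List.append_assoc,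
      before_lin hxu'.1 hxu'.2]
    simp
  have hy : ¬ Lin (p₀ ++ s :: p₁ ++ (y :: u₁ ++ x :: u₂)) y := by
    rw [List.cons_append, not_lin_split]; exact Or.inl hyx
  have h1 : [s, y, x].Sublist (p₀ ++ s :: (p₁ ++ x :: v)) := by
    have h2 : [s, y, x].Sublist (p₀ ++ s :: p₁ ++ (y :: u₁ ++ x :: u₂)) := by
      simp
    simpa using (hinv.between s y x hs hxu).1 h2
  rw [between_lin (by simpa using (hinv.lin s).1 hs) (by simpa using hx)] at h1
  obtain ⟨b₁, b₂, rfl⟩ := List.append_of_mem h1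
  have h3 := Minimal.not_mem (x := y) (a := p₀ ++ s :: b₁) (b := b₂) (c := u₁ ++ x :: u₂) hV
    (by simpa using hmin) (fun z hz => by simpa using hp₁ z (by simp [hz]))
  have h4 : ¬ Lin ((p₀ ++ s :: b₁) ++ y :: (b₂ ++ x :: v)) y := by
    rw [hinv.lin] at hy; simpa using hy
  rw [not_lin_split] at h4
  have hne : y ≠ x := by rintro rfl; simp at h3
  have h5 : y ∈ v := by
    have := h4.resolve_left h3.1
    simpa [hne, h3.2.1] using this
  rw [← after_lin hxp.1 hxp.2, ← hinv.after y x hxu, ← List.append_assoc,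
    after_lin hxu'.1 hxu'.2] at h5
  simp [h5] at h3

/-- The letter `x` must occur in `u` before its first linear letter `t`. Otherwise the block
invariant puts `x` in the last block of `p`, so `x` is repeated within a block of the minimal word
`p ++ x :: v` and occurs nowhere else there. Its second occurrence in `p ++ u` must come after `t`,
which the last-occurrence invariant then forbids. -/
theorem exists_split_of_not_lin (hV : V ≤ definedBy basisA0Q) (hmin : V.Minimal (p ++ x :: v))
    (hinv : InvQ (p ++ u) (p ++ x :: v)) (hx : ¬ Lin (p ++ x :: v) x)
    (hp : ∃ s ∈ p, Lin (p ++ u) s) (hu : ∃ t ∈ u, Lin (p ++ u) t) :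
    ∃ u₁ u₂, u = u₁ ++ x :: u₂ ∧ x ∉ u₁ ∧ (∀ z ∈ u₁, ¬ Lin (p ++ u) z) ∧
      ∃ t ∈ u₂, Lin (p ++ u) t := by
  obtain ⟨p₀, s, p₁, rfl, hs, hp₁⟩ := exists_last_split hp
  obtain ⟨g, t, g', rfl, ht, hg⟩ := exists_first_split hu
  have hxt : x ≠ t := by rintro rfl; exact hx ((hinv.lin _).1 ht)
  by_cases hxg : x ∈ g
  · obtain ⟨u₁, u₂, rfl, hxu₁⟩ := exists_split_of_mem hxg
    refine ⟨u₁, u₂ ++ t :: g', by simp, hxu₁, fun z hz => hg z (by simp [hz]), t, by simp, ht⟩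
  exfalso
  have ht' : t ∉ p₀ ++ s :: p₁ ++ g ∧ t ∉ g' := by rw [← lin_split]; simpa using ht
  have htv : t ∈ v := by
    have := (hinv.mem t).1 ht.mem
    have h2 : t ∉ p₀ ++ s :: p₁ := fun h => ht'.1 (List.mem_append_left _ h)
    simpa [hxt.symm] using (List.mem_append.1 this).resolve_left h2
  obtain ⟨v₁, v₂, rfl⟩ := List.append_of_mem htv
  have h1 : [s, x, t].Sublist (p₀ ++ s :: (p₁ ++ g ++ t :: g')) := by
    have h2 : [s, x, t].Sublist (p₀ ++ s :: p₁ ++ x :: (v₁ ++ t :: v₂)) := by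
      simp
    simpa using (hinv.between s x t hs ht).2 h2
  rw [between_lin (by simpa using hs) (by simpa using ht)] at h1
  obtain ⟨b₁, b₂, rfl⟩ := List.append_of_mem ((List.mem_append.1 h1).resolve_right hxg)
  have h3 := Minimal.not_mem (x := x) (a := p₀ ++ s :: b₁) (b := b₂) (c := v₁ ++ t :: v₂) hV
    (by simpa using hmin) (fun z hz hlin => hp₁ z (by simp [hz]) ((hinv.lin z).2 (by simpa using hlin)))
  have h4 : ¬ Lin ((p₀ ++ s :: b₁) ++ x :: (b₂ ++ (g ++ t :: g'))) x := by
    rw [← hinv.lin] at hx; simpa using hx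
  rw [not_lin_split] at h4
  have h5 : x ∈ g' := by
    have := h4.resolve_left h3.1
    simpa [hxt, h3.2.1, hxg] using this
  rw [← after_lin ht'.1 ht'.2, List.append_assoc, hinv.after x t ht] at h5
  have ht2 : Lin ((p₀ ++ s :: (b₁ ++ x :: b₂) ++ x :: v₁) ++ t :: v₂) t := by
    simpa using (hinv.lin t).1 ht
  have h6 := lin_split.1 ht2
  rw [show p₀ ++ s :: (b₁ ++ x :: b₂) ++ x :: (v₁ ++ t :: v₂) =
    (p₀ ++ s :: (b₁ ++ x :: b₂) ++ x :: v₁) ++ t :: v₂ by simp, after_lin h6.1 h6.2] at h5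
  simp [h5] at h3

/-- Under `xxyy ≈ xyxy` adjacent occurrences of nonlinear letters always commute. In the new case,
with `z` on the left and `x` on the right, `zx` passes through `zzxx`, `zxzx`, `xzzx`, `xzx` and
`xxz` to `xz`. -/
theorem swap_of_comm (hV : V ≤ definedBy basisA0Q) (hc : V.Eqv [0, 0, 1, 1] [0, 1, 0, 1])
    {q : List ℕ} {z : ℕ} (hz : z ∈ p ∨ z ∈ q) (hx : x ∈ p ∨ x ∈ q) :
    V.Eqv (p ++ z :: x :: q) (p ++ x :: z :: q) := by
  have key {p q : List ℕ} {x z : ℕ} (hz : z ∈ p) (hx : x ∈ q) :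
      V.Eqv (p ++ z :: x :: q) (p ++ x :: z :: q) := by
    obtain ⟨p₁, p₂, rfl⟩ := List.append_of_mem hz
    obtain ⟨q₁, q₂, rfl⟩ := List.append_of_mem hx
    have h1 : V.Eqv (p₁ ++ z :: p₂ ++ z :: x :: (q₁ ++ x :: q₂))
        (p₁ ++ z :: p₂ ++ z :: z :: x :: x :: (q₁ ++ x :: q₂)) := by
      have e1 := contract (p := p₁ ++ z :: p₂) (x := z) (q := x :: (q₁ ++ x :: q₂)) hV (by simp)
      have e2 := contract (p := p₁ ++ z :: p₂ ++ [z, z]) (x := x) (q := q₁ ++ x :: q₂) hV (by simp)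
      simp only [List.append_assoc, List.cons_append, List.nil_append] at e1 e2 ⊢
      exact e1.symm.trans e2.symm
    have h2 : V.Eqv (p₁ ++ z :: p₂ ++ z :: z :: x :: x :: (q₁ ++ x :: q₂))
        (p₁ ++ z :: p₂ ++ z :: x :: z :: x :: (q₁ ++ x :: q₂)) := by
      refine Eqv.append_left _ (Eqv.append_right (u := [z, z, x, x]) (v := [z, x, z, x])
        (fun M hM φ => ?_) (q₁ ++ x :: q₂))
      simpa using hc M hM fun n => if n = 0 then φ z else φ x
    have h3 := swap_of_mem_right (p := p₁ ++ z :: p₂) (z := z) (x := x)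
      (q := z :: x :: (q₁ ++ x :: q₂)) hV (by simp) (by simp)
    have h4 := contract (p := p₁ ++ z :: p₂ ++ [x]) (x := z) (q := x :: (q₁ ++ x :: q₂)) hV (by simp)
    have h5 := swap_of_mem_left (p := p₁ ++ z :: p₂ ++ [x]) (z := z) (x := x) (q := q₁ ++ x :: q₂) hV
      (by simp) (by simp)
    have h6 := contract (p := p₁ ++ z :: p₂) (x := x) (q := z :: (q₁ ++ x :: q₂)) hV (by simp)
    simp only [List.append_assoc, List.cons_append, List.nil_append] at h1 h2 h3 h4 h5 h6 ⊢
    exact h1.trans (h2.trans (h3.trans (h4.trans (h5.trans h6))))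
  rcases hz with hz | hz <;> rcases hx with hx | hx
  · exact swap_of_mem_left hV hz hx
  · exact key hz hx
  · exact (key hx hz).symm
  · exact swap_of_mem_right hV hz hx

/-- Without `xxyy ≈ xyxy`, the letters `z` and `x` can be swapped only if both occur again on a
common side. If they did not, the subwords `zx` and `xz`, preserved by the `A₀` invariant, would
force a letter to be repeated within a block of a minimal word although it also occurs elsewhere.
For `x` in `p` this concerns `x` in the second word; otherwise it concerns `z` in the first. -/
theorem swap_of_invA0 (hV : V ≤ definedBy basisA0Q) (hmin : V.Minimal (p ++ (u₁ ++ x :: u₂)))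
    (hmin' : V.Minimal (p ++ x :: v)) (hinv : InvQ (p ++ (u₁ ++ x :: u₂)) (p ++ x :: v))
    (hA0 : InvA0 (p ++ (u₁ ++ x :: u₂)) (p ++ x :: v)) (hx : ¬ Lin (p ++ x :: v) x)
    (hxu₁ : x ∉ u₁) (hlin : ∀ z ∈ u₁, ¬ Lin (p ++ (u₁ ++ x :: u₂)) z)
    (hp : ∃ s ∈ p, Lin (p ++ (u₁ ++ x :: u₂)) s) (hu : ∃ t ∈ u₂, Lin (p ++ (u₁ ++ x :: u₂)) t)
    {a b : List ℕ} {z : ℕ} (hab : u₁ = a ++ z :: b) :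
    (z ∈ p ++ a ∧ x ∈ p ++ a) ∨ (z ∈ b ++ u₂ ∧ x ∈ b ++ u₂) := by
  obtain ⟨p₀, s, p₁, rfl, hs, hp₁⟩ := exists_last_split hp
  have hxz : x ≠ z := by rintro rfl; exact hxu₁ (by simp [hab])
  have hz : z ∈ (p₀ ++ s :: p₁) ++ a ∨ z ∈ b ++ x :: u₂ := by
    rw [← not_lin_split]; simpa [hab] using hlin z (by simp [hab])
  have hx' : x ∈ (p₀ ++ s :: p₁) ++ u₁ ∨ x ∈ u₂ := by
    rw [← not_lin_split]; rw [← hinv.lin] at hx; simpa using hx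
  by_cases hxp : x ∈ p₀ ++ s :: p₁
  · by_cases hxu : x ∈ u₂
    · simp [hxz.symm] at hz ⊢; simp at hxp; tauto
    · left
      refine ⟨?_, by simp at hxp ⊢; tauto⟩
      by_contra hzp
      have h1 : [z, x].Sublist (p₀ ++ s :: p₁ ++ (u₁ ++ x :: u₂)) := by
        rw [pair_sublist_append, pair_sublist_append]
        simp [hab]
      rw [hA0.pair, pair_sublist_append, pair_sublist_cons] at h1
      have hzp' : z ∉ p₀ ++ s :: p₁ := fun h => hzp (List.mem_append_left _ h)
      have h2 : [z, x].Sublist v := by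
        rcases h1 with h1 | h1 | h1 | h1
        · exact absurd (mem_left_of_pair h1) hzp'
        · exact absurd h1.1 hzp'
        · exact absurd h1.1.symm hxz
        · exact h1
      obtain ⟨c, t, d, rfl, ht, hc⟩ := exists_first_split hu
      have ht1 : t ∉ p₀ ++ s :: p₁ ++ (u₁ ++ x :: c) ∧ t ∉ d := by
        rw [← lin_split]; simpa using ht
      have hxt : ¬ [t, x].Sublist (p₀ ++ s :: p₁ ++ (u₁ ++ x :: (c ++ t :: d))) := by
        rw [show p₀ ++ s :: p₁ ++ (u₁ ++ x :: (c ++ t :: d)) =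
          p₀ ++ s :: p₁ ++ (u₁ ++ x :: c) ++ t :: d by simp, after_lin ht1.1 ht1.2]
        exact fun h => hxu (by simp [h])
      rw [hinv.after x t ht] at hxt
      have ht2 := (hinv.lin t).1 ht
      have htv : t ∈ v := by
        have := ht2.mem
        simp at this ht1
        grind
      obtain ⟨v₁, v₂, rfl⟩ := List.append_of_mem htv
      have ht3 : t ∉ p₀ ++ s :: p₁ ++ x :: v₁ ∧ t ∉ v₂ := by
        rw [← lin_split]; simpa using ht2
      rw [show p₀ ++ s :: p₁ ++ x :: (v₁ ++ t :: v₂) =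
          p₀ ++ s :: p₁ ++ x :: v₁ ++ t :: v₂ by simp, after_lin ht3.1 ht3.2] at hxt
      have hxv₁ : x ∈ v₁ := by
        have := mem_right_of_pair h2
        simp [hxt] at this
        rcases this with h | h
        · exact h
        · subst h; exact absurd hxp (by simp at ht1 ⊢)
      obtain ⟨c₁, c₂, rfl⟩ := List.append_of_mem hxv₁
      have h3 := Minimal.not_mem (x := x) (a := p₀ ++ s :: p₁) (b := c₁) (c := c₂ ++ t :: v₂) hV
        (by simpa using hmin') (fun r hr hlinr => ?_)
      · exact h3.1 hxp
      -- A linear `r` between the two occurrences of `x` would also precede `t` in the first word,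
      -- but outside `p` only nonlinear letters precede `t` there.
      · replace hlinr : Lin (p₀ ++ s :: p₁ ++ x :: (c₁ ++ x :: c₂ ++ t :: v₂)) r := by
          simpa using hlinr
        obtain ⟨d₁, d₂, rfl⟩ := List.append_of_mem hr
        have hr1 : r ∉ p₀ ++ s :: p₁ ++ x :: d₁ ∧ r ∉ d₂ ++ x :: c₂ ++ t :: v₂ := by
          rw [← lin_split]; simpa using hlinr
        have h4 : [r, t].Sublist (p₀ ++ s :: p₁ ++ (u₁ ++ x :: (c ++ t :: d))) := by
          rw [hA0.pair]
          refine List.Sublist.trans ?_ (List.sublist_append_right _ _)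
          simp
        rw [show p₀ ++ s :: p₁ ++ (u₁ ++ x :: (c ++ t :: d)) =
          p₀ ++ s :: p₁ ++ (u₁ ++ x :: c) ++ t :: d by simp, before_lin ht1.1 ht1.2] at h4
        have hr2 := (hinv.lin r).2 hlinr
        have h5 := fun h => hlin r h hr2
        have h6 := fun h => hc r h hr2
        simp at h4 hr1
        grind
  · have hxu : x ∈ u₂ := hx'.resolve_left (by simp at hxp ⊢; tauto)
    refine Or.inr ⟨?_, by simp [hxu]⟩
    by_contra hzu
    -- In the second word `x` follows `p`, so the absence of the subword `xz` excludes `z` from `v`.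
    -- As `z` follows `s`, it must lie in `p₁`, and is thus repeated within one block of the first
    -- word.
    have h1 : ¬ [x, z].Sublist (p₀ ++ s :: p₁ ++ (u₁ ++ x :: u₂)) := by
      rw [← List.append_assoc, pair_sublist_append, pair_sublist_cons]
      have : x ∉ p₀ ++ s :: p₁ ++ u₁ := by simp at hxp ⊢; tauto
      have hzu₂ : z ∉ u₂ := fun h => hzu (by simp [h])
      rintro (h | h | h | h)
      · exact this (mem_left_of_pair h)
      · exact this h.1
      · exact hzu₂ h.2
      · exact hzu₂ (mem_right_of_pair h)
    rw [hA0.pair, pair_sublist_append, pair_sublist_cons] at h1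
    have hzv : z ∉ v := fun h => h1 (Or.inr (Or.inr (Or.inl ⟨rfl, h⟩)))
    have h2 : [s, z].Sublist (p₀ ++ s :: (p₁ ++ x :: v)) := by
      have : [s, z].Sublist (p₀ ++ s :: p₁ ++ (u₁ ++ x :: u₂)) := by
        simp [hab]
      simpa using (hA0.pair s z).1 this
    have hs' : Lin (p₀ ++ s :: (p₁ ++ x :: v)) s := by simpa using (hinv.lin s).1 hs
    rw [lin_split] at hs'
    rw [after_lin hs'.1 hs'.2] at h2
    have h3 : z ∈ p₁ := by simpa [hxz.symm, hzv] using h2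
    obtain ⟨b₁, b₂, rfl⟩ := List.append_of_mem h3
    have h4 := Minimal.not_mem (x := z) (a := p₀ ++ s :: b₁) (b := b₂ ++ a) (c := b ++ x :: u₂) hV
      (by simpa [hab] using hmin) (fun r hr => ?_)
    · have h5 : ¬ Lin ((p₀ ++ s :: b₁) ++ z :: (b₂ ++ x :: v)) z := by
        have := hlin z (by simp [hab])
        rw [hinv.lin] at this
        simpa using this
      rw [not_lin_split] at h5
      rcases h5 with h5 | h5
      · exact h4.1 h5
      · simp [hxz.symm, hzv] at h5
        exact h4.2.1 (by simp [h5])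
    · rcases List.mem_append.1 hr with hr | hr
      · simpa [hab] using hp₁ r (by simp [hr])
      · simpa [hab] using hlin r (by simp [hab, hr])

/-- Words of minimal length with a common prefix, a common last letter and the same invariants are
equal in `V`. -/
theorem eqv_of_minimal (hV : V ≤ definedBy basisA0Q) (hQ : ∀ u v, V.Eqv u v → InvQ u v)
    {t : ℕ} (hC : V.Eqv [0, 0, 1, 1] [0, 1, 0, 1] ∨ ∀ u v, V.Eqv u v → InvA0 u v)
    (hinv : InvQ (p ++ (u ++ [t])) (p ++ (v ++ [t])))
    (hinv' : V.Eqv [0, 0, 1, 1] [0, 1, 0, 1] ∨ InvA0 (p ++ (u ++ [t])) (p ++ (v ++ [t])))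
    (hmin : V.Minimal (p ++ (u ++ [t]))) (hmin' : V.Minimal (p ++ (v ++ [t])))
    (hp : ∃ s ∈ p, Lin (p ++ (u ++ [t])) s) (ht : Lin (p ++ (u ++ [t])) t) :
    V.Eqv (p ++ (u ++ [t])) (p ++ (v ++ [t])) := by
  have htpu : t ∉ p ∧ t ∉ u := by
    have : t ∉ p ++ u ∧ t ∉ [] := by rw [← lin_split]; simpa using ht
    simpa using this
  induction v generalizing p u with
  | nil =>
    obtain ⟨u', hu'⟩ := eq_cons_of_lin hV hmin hinv ((hinv.lin t).1 ht) hp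
    rcases u with _ | ⟨a, u⟩
    · exact Eqv.refl _ _
    · simp only [List.cons_append, List.cons.injEq] at hu'
      simp [hu'.1] at htpu
  | cons x v ih =>
    have htx : x ≠ t := by
      have := (hinv.lin t).1 ht
      have : t ∉ p ++ x :: v ∧ t ∉ [] := by rw [← lin_split]; simpa using this
      rintro rfl
      simp at this
    -- Once `x` heads the remainder of the first word, it joins the common prefix. The rewritten
    -- word has the same length, hence is still minimal, and it has the same invariants because it
    -- is equal in `V`.
    have step (u' : List ℕ) (hlen : u'.length + 1 = u.length)
        (hu' : V.Eqv (p ++ (u ++ [t])) (p ++ x :: (u' ++ [t]))) :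
        V.Eqv (p ++ (u ++ [t])) (p ++ (x :: v ++ [t])) := by
      refine hu'.trans ?_
      have e1 (w : List ℕ) : p ++ x :: (w ++ [t]) = (p ++ [x]) ++ (w ++ [t]) := by simp
      have hI := hQ _ _ hu'
      have hI2 := (hQ _ _ hu').symm.trans hinv
      have hm := hmin.of_eqv hu' (by simp [← hlen])
      rw [List.cons_append] at hinv' hmin' hI2 ⊢
      rw [e1, e1]
      rw [e1] at hI hm
      have ht' := (hI.lin t).1 ht
      refine ih (by simpa using hI2) ?_ hm (by simpa using hmin') ?_ ht' ?_
      · rcases hC with hC | hC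
        · exact Or.inl hC
        · refine hinv'.imp_right fun h => ?_
          simpa using (hC _ _ hu').symm.trans h
      · obtain ⟨s, hsp, hs⟩ := hp
        exact ⟨s, by simp [hsp], (hI.lin s).1 hs⟩
      · have : t ∉ p ++ [x] ++ u' ∧ t ∉ [] := by rw [← lin_split]; simpa using ht'
        simpa [and_assoc] using this
    by_cases hx : Lin (p ++ (x :: v ++ [t])) x
    · obtain ⟨u', hu'⟩ := eq_cons_of_lin hV hmin hinv hx hp
      rcases u with _ | ⟨a, u⟩
      · simp at hu'; exact absurd hu'.1.symm htx
      · simp only [List.cons_append, List.cons.injEq] at hu'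
        obtain ⟨rfl, -⟩ := hu'
        exact step u (by simp) (Eqv.refl _ _)
    · obtain ⟨u₁, u₂, hu, hxu₁, hlin, hu₂⟩ :=
        exists_split_of_not_lin hV hmin' hinv hx hp ⟨t, by simp, ht⟩
      have hmove : V.Eqv (p ++ (u₁ ++ x :: u₂)) (p ++ x :: (u₁ ++ u₂)) := by
        refine move_left fun a z b hab => ?_
        rw [hu] at hinv hinv' hmin hp ht hlin hu₂
        rcases hC with hC | hC
        · have hz : z ∈ (p ++ a) ∨ z ∈ b ++ x :: u₂ := by
            rw [← not_lin_split]; simpa [hab] using hlin z (by simp [hab])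
          have hx' : x ∈ p ++ u₁ ∨ x ∈ u₂ := by
            rw [← not_lin_split]; rw [← hinv.lin] at hx; simpa using hx
          have hxz : x ≠ z := by rintro rfl; exact hxu₁ (by simp [hab])
          simp [hxu₁] at hx'
          refine swap_of_comm hV hC (by simpa [hxz.symm] using hz) ?_
          simp; tauto
        · have hA : InvA0 (p ++ (u₁ ++ x :: u₂)) (p ++ x :: (v ++ [t])) := by
            -- The first alternative is impossible: `yx` is a subword of `xyxy` but not of `xxyy`.
            rcases hinv' with hinv' | hinv'
            · have := (hC _ _ hinv').pair 1 0
              simp [pair_sublist_cons] at this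
            · exact hinv'
          rcases swap_of_invA0 hV hmin hmin' hinv hA hx hxu₁ hlin hp hu₂ hab with h | h
          · exact swap_of_mem_left hV h.1 h.2
          · exact swap_of_mem_right hV h.1 h.2
      rcases List.eq_nil_or_concat u₂ with rfl | ⟨u₂, r, rfl⟩
      · simp at hu₂
      · have : u = u₁ ++ x :: u₂ ∧ t = r := by
          simp only [List.concat_eq_append] at hu
          rw [← List.cons_append, ← List.append_assoc] at hu
          simpa using List.append_inj' hu rfl
        obtain ⟨rfl, rfl⟩ := this
        refine step (u₁ ++ u₂) (by simp; omega) ?_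
        simpa using hmove

end Engine

/-! ### Enclosing words between fresh linear letters -/

section Wrap

variable {u v : List ℕ} {s t : ℕ}

theorem lin_wrap (hs : s ∉ u) (ht : t ∉ u) (hst : s ≠ t) {x : ℕ} :
    Lin (s :: (u ++ [t])) x ↔ Lin u x ∨ x = s ∨ x = t := by
  simp only [lin_iff, pair_sublist_cons, pair_sublist_append, List.mem_cons, List.mem_append]
  grind [mem_left_of_pair]

theorem InvA0.wrap (h : InvA0 u v) : InvA0 (s :: (u ++ [t])) (s :: (v ++ [t])) where
  mem x := by simp [h.mem]
  pair x y := by simp [pair_sublist_cons, pair_sublist_append, h.mem, h.pair]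

theorem InvQ.wrap (h : InvQ u v) (hs : s ∉ u) (ht : t ∉ u) (hst : s ≠ t) :
    InvQ (s :: (u ++ [t])) (s :: (v ++ [t])) where
  mem x := by simp [h.mem]
  lin x := by
    rw [lin_wrap hs ht hst, lin_wrap (by rwa [← h.mem]) (by rwa [← h.mem]) hst, h.lin]
  before x r hr := by
    rw [lin_wrap hs ht hst] at hr
    have h1 := h.before x r
    have h2 := h.mem
    simp only [pair_sublist_cons, pair_sublist_append, List.mem_cons, List.mem_append]
    grind [mem_right_of_pair]
  after x r hr := by
    rw [lin_wrap hs ht hst] at hr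
    have h1 := h.after x r
    have h2 := h.mem
    simp only [pair_sublist_cons, pair_sublist_append, List.mem_cons, List.mem_append]
    grind [mem_left_of_pair]
  between a x b ha hb := by
    rw [lin_wrap hs ht hst] at ha hb
    have h1 := h.between a x b
    have h2 := h.mem
    have h3 := h.before x b
    have h4 := h.after x a
    simp only [triple_sublist_cons, triple_sublist_append, pair_sublist_cons, pair_sublist_append,
      List.mem_cons]
    have a1 : ∀ l : List ℕ, [a, x, b].Sublist l → a ∈ l := fun l h => h.subset (by simp)
    have a2 : ∀ l : List ℕ, [a, x, b].Sublist l → b ∈ l := fun l h => h.subset (by simp)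
    grind [mem_left_of_pair, mem_right_of_pair]

/-- Substituting `1` for the two outer letters removes them. They are added because the matching
argument needs every block bounded by linear letters. -/
theorem eqv_of_wrap {V : MonoidVariety.{u}} (hs : s ∉ u ++ v) (ht : t ∉ u ++ v)
    (h : V.Eqv (s :: (u ++ [t])) (s :: (v ++ [t]))) : V.Eqv u v := by
  intro M hM φ
  have := h M hM fun n => if n = s ∨ n = t then 1 else φ n
  have key (w : List ℕ) (hw : ∀ a ∈ w, a ∈ u ++ v) :
      w.map (fun n => if n = s ∨ n = t then 1 else φ n) = w.map φ :=
    List.map_congr_left fun a ha => if_neg (by rintro (rfl | rfl) <;> grind)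
  simpa [key u (by simp +contextual), key v (by simp +contextual)] using this

end Wrap

/-- Nothing may precede the linear letter `s` or follow the linear letter `t`, so passing to a
minimal word keeps both at the ends. -/
theorem InvQ.eq_wrap {u w : List ℕ} {s t : ℕ} (h : InvQ (s :: (u ++ [t])) w) (hs : s ∉ u)
    (ht : t ∉ u) (hst : s ≠ t) : ∃ w', w = s :: (w' ++ [t]) := by
  have hs' : Lin (s :: (u ++ [t])) s := by simp [lin_wrap hs ht hst]
  have ht' : Lin (s :: (u ++ [t])) t := by simp [lin_wrap hs ht hst]
  obtain ⟨a, b, rfl, ha, hb⟩ := ((h.lin s).1 hs').exists_split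
  have ha' : a = [] := List.eq_nil_iff_forall_not_mem.2 fun z hz => by
    have h1 := (h.before z s hs').2 ((before_lin ha hb).2 hz)
    rw [pair_sublist_cons, pair_sublist_append] at h1
    grind [mem_right_of_pair]
  subst ha'
  obtain ⟨c, d, hcd, hc, hd⟩ := ((h.lin t).1 ht').exists_split
  have hd' : d = [] := List.eq_nil_iff_forall_not_mem.2 fun z hz => by
    have h1 := (h.after z t ht').2 (by rw [hcd]; exact (after_lin hc hd).2 hz)
    rw [pair_sublist_cons, pair_sublist_append] at h1
    grind [mem_left_of_pair]
  subst hd'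
  rcases c with _ | ⟨r, c⟩
  · simp at hcd; exact absurd hcd.1 hst
  · simp at hcd ⊢; exact ⟨c, hcd.2⟩

/-- Solution of the word problem, both for the variety `A₀ ∨ Q` and for the variety `Q`. -/
theorem eqv_of_invQ {V : MonoidVariety.{u}} (hV : V ≤ definedBy basisA0Q)
    (hQ : ∀ u v, V.Eqv u v → InvQ u v)
    (hC : V.Eqv [0, 0, 1, 1] [0, 1, 0, 1] ∨ ∀ u v, V.Eqv u v → InvA0 u v) {u v : List ℕ}
    (hinv : InvQ u v) (hinv' : V.Eqv [0, 0, 1, 1] [0, 1, 0, 1] ∨ InvA0 u v) : V.Eqv u v := by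
  obtain ⟨s, hs⟩ := Infinite.exists_notMem_finset (u ++ v).toFinset
  obtain ⟨t, ht⟩ := Infinite.exists_notMem_finset (s :: (u ++ v)).toFinset
  simp only [List.mem_toFinset, List.mem_cons, not_or] at hs ht
  have hst : s ≠ t := Ne.symm ht.1
  have hsu : s ∉ u := fun h => hs (List.mem_append_left _ h)
  have hsv : s ∉ v := fun h => hs (List.mem_append_right _ h)
  have htu : t ∉ u := fun h => ht.2 (List.mem_append_left _ h)
  have htv : t ∉ v := fun h => ht.2 (List.mem_append_right _ h)
  obtain ⟨u', hu, humin⟩ := exists_minimal V (s :: (u ++ [t]))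
  obtain ⟨v', hv, hvmin⟩ := exists_minimal V (s :: (v ++ [t]))
  obtain ⟨u', rfl⟩ := (hQ _ _ hu).eq_wrap hsu htu hst
  obtain ⟨v', rfl⟩ := (hQ _ _ hv).eq_wrap hsv htv hst
  have key := eqv_of_minimal (p := [s]) (u := u') (v := v') (t := t) hV hQ hC
    ((hQ _ _ hu).symm.trans ((hinv.wrap hsu htu hst).trans (hQ _ _ hv))) ?_ humin hvmin
    ⟨s, by simp, ((hQ _ _ hu).lin s).1 (by simp [lin_wrap hsu htu hst])⟩
    (((hQ _ _ hu).lin t).1 (by simp [lin_wrap hsu htu hst]))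
  · exact eqv_of_wrap hs ht.2 (hu.trans (key.trans hv.symm))
  · rcases hC with hC | hC
    · exact Or.inl hC
    · exact hinv'.imp_right fun h => (hC _ _ hu).symm.trans (h.wrap.trans (hC _ _ hv))

/-! ## Invariants from substitutions -/

section Invariants

variable {M : Type*} [Monoid M] {u v w : List ℕ}

theorem prod_map_eq_pow {φ : ℕ → M} {x : ℕ} (h : ∀ z ∈ w, z ≠ x → φ z = 1) :
    (w.map φ).prod = φ x ^ w.count x := by
  induction w with
  | nil => simp
  | cons a w ih =>
    have := ih fun z hz => h z (by simp [hz])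
    rcases eq_or_ne a x with rfl | ha
    · simp [this, pow_succ']
    · simp [this, h a (by simp) ha, ha]

theorem Lin.exists_split_pair {s t : ℕ} (hs : Lin w s) (ht : Lin w t) (h : [s, t].Sublist w) :
    ∃ p q r, w = p ++ s :: (q ++ t :: r) := by
  obtain ⟨p, q, rfl, hp, hq⟩ := hs.exists_split
  obtain ⟨a, b, rfl⟩ := List.append_of_mem ((after_lin hp hq).1 h)
  exact ⟨p, a, b, rfl⟩

theorem lin_split_pair {p q r : List ℕ} {s t : ℕ} (hs : Lin (p ++ s :: (q ++ t :: r)) s)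
    (ht : Lin (p ++ s :: (q ++ t :: r)) t) :
    s ≠ t ∧ (s ∉ p ∧ s ∉ q ∧ s ∉ r) ∧ (t ∉ p ∧ t ∉ q ∧ t ∉ r) := by
  have h1 := lin_split.1 hs
  have h2 : t ∉ p ++ s :: q ∧ t ∉ r := by rw [← lin_split]; simpa using ht
  simp at h1 h2
  grind

/-- The detecting element is a parameter here and in the analogous lemmas. These serve the concrete
generators, and some also serve arbitrary members of a variety in which an identity is to be
refuted. -/
theorem Models.mem (h : Models M u v) (e : M) (he : ∀ k, e ^ k = 1 ↔ k = 0) (x : ℕ) :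
    x ∈ u ↔ x ∈ v := by
  have h1 := h fun n => if n = x then e else 1
  rw [prod_map_eq_pow (x := x) (by simp +contextual),
    prod_map_eq_pow (x := x) (by simp +contextual)] at h1
  have h2 : (if x = x then e else 1) ^ u.count x = 1 ↔ (if x = x then e else 1) ^ v.count x = 1 := by
    rw [h1]
  simp only [if_true, he, List.count_eq_zero] at h2
  tauto

theorem Models.lin (h : Models M u v) (a : M) (ha : ∀ k, a ^ k = a ↔ k = 1) (x : ℕ) :
    Lin u x ↔ Lin v x := by
  have h1 := h fun n => if n = x then a else 1
  rw [prod_map_eq_pow (x := x) (by simp +contextual),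
    prod_map_eq_pow (x := x) (by simp +contextual)] at h1
  simp only [if_true] at h1
  rw [Lin, Lin, ← ha, ← ha, h1]

theorem prod_map_lin {p q : List ℕ} {x s : ℕ} (hp : s ∉ p) (hq : s ∉ q) (hxs : x ≠ s) (e b : M) :
    ((p ++ s :: q).map fun n => if n = x then e else if n = s then b else 1).prod =
      e ^ p.count x * b * e ^ q.count x := by
  have key (l : List ℕ) (hl : s ∉ l) :
      (l.map fun n => if n = x then e else if n = s then b else 1).prod = e ^ l.count x := by
    rw [prod_map_eq_pow (x := x) fun z hz hzx => by grind]; simp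
  simp [key p hp, key q hq, hxs.symm, mul_assoc]

theorem not_pair_self_of_lin {s : ℕ} (h : Lin u s) : ¬ [s, s].Sublist u := (lin_iff.1 h).2

theorem Models.before (h : Models M u v) (e b : M) (hb : ∀ i j, e ^ i * b * e ^ j = b ↔ i = 0)
    {x s : ℕ} (hu : Lin u s) (hv : Lin v s) : [x, s].Sublist u ↔ [x, s].Sublist v := by
  rcases eq_or_ne x s with rfl | hxs
  · simp [not_pair_self_of_lin hu, not_pair_self_of_lin hv]
  obtain ⟨p, q, rfl, hp, hq⟩ := hu.exists_split
  obtain ⟨p', q', rfl, hp', hq'⟩ := hv.exists_split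
  have h1 := h fun n => if n = x then e else if n = s then b else 1
  rw [prod_map_lin hp hq hxs, prod_map_lin hp' hq' hxs] at h1
  have h2 : e ^ p.count x * b * e ^ q.count x = b ↔ e ^ p'.count x * b * e ^ q'.count x = b := by
    rw [h1]
  rw [hb, hb, List.count_eq_zero, List.count_eq_zero] at h2
  rw [before_lin hp hq, before_lin hp' hq']
  tauto

theorem Models.after (h : Models M u v) (e b : M) (hb : ∀ i j, e ^ i * b * e ^ j = b ↔ j = 0)
    {x s : ℕ} (hu : Lin u s) (hv : Lin v s) : [s, x].Sublist u ↔ [s, x].Sublist v := by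
  rcases eq_or_ne x s with rfl | hxs
  · simp [not_pair_self_of_lin hu, not_pair_self_of_lin hv]
  obtain ⟨p, q, rfl, hp, hq⟩ := hu.exists_split
  obtain ⟨p', q', rfl, hp', hq'⟩ := hv.exists_split
  have h1 := h fun n => if n = x then e else if n = s then b else 1
  rw [prod_map_lin hp hq hxs, prod_map_lin hp' hq' hxs] at h1
  have h2 : e ^ p.count x * b * e ^ q.count x = b ↔ e ^ p'.count x * b * e ^ q'.count x = b := by
    rw [h1]
  rw [hb, hb, List.count_eq_zero, List.count_eq_zero] at h2
  rw [after_lin hp hq, after_lin hp' hq']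
  tauto

theorem prod_map_split_pair {p q r : List ℕ} {s x t : ℕ} (hs : Lin (p ++ s :: (q ++ t :: r)) s)
    (ht : Lin (p ++ s :: (q ++ t :: r)) t) (hxs : x ≠ s) (hxt : x ≠ t) (a e b : M) :
    ((p ++ s :: (q ++ t :: r)).map fun n => if n = x then e else if n = s then a else
      if n = t then b else 1).prod =
      e ^ p.count x * a * (e ^ q.count x) * b * e ^ r.count x := by
  obtain ⟨hst, ⟨h1, h2, h3⟩, h4, h5, h6⟩ := lin_split_pair hs ht
  have key (l : List ℕ) (hl : s ∉ l) (hl' : t ∉ l) :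
      (l.map fun n => if n = x then e else if n = s then a else if n = t then b else 1).prod =
        e ^ l.count x := by
    rw [prod_map_eq_pow (x := x) fun z hz hzx => by grind]; simp
  simp [key p h1 h4, key q h2 h5, key r h3 h6, hxs.symm, hxt.symm, hst.symm, mul_assoc]

theorem Lin.pair_total {s t : ℕ} (hs : Lin u s) (ht : Lin u t) (hst : s ≠ t) :
    [s, t].Sublist u ↔ ¬ [t, s].Sublist u := by
  obtain ⟨p, q, rfl, hp, hq⟩ := hs.exists_split
  rw [after_lin hp hq, before_lin hp hq]
  have h1 := ht.mem
  have h2 := (lin_iff.1 ht).2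
  rw [pair_sublist_append, pair_sublist_cons] at h2
  simp [hst.symm] at h1
  tauto

theorem triple_false_left {s x t : ℕ} (hs : Lin u s) (h : s = t ∨ s = x ∨ t = x) (ht : Lin u t) :
    ¬ [s, x, t].Sublist u := by
  intro hsub
  rcases h with rfl | rfl | rfl
  · exact not_pair_self_of_lin hs ((show [s, s].Sublist [s, x, s] by simp).trans hsub)
  · exact not_pair_self_of_lin hs ((show [s, s].Sublist [s, s, t] by simp).trans hsub)
  · exact not_pair_self_of_lin ht ((show [t, t].Sublist [s, t, t] by simp).trans hsub)

theorem pair_of_triple {s x t : ℕ} (h : [s, x, t].Sublist u) : [s, t].Sublist u :=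
  (show [s, t].Sublist [s, x, t] by simp).trans h

/-- Under `s ↦ a`, `x ↦ e`, `t ↦ b` and all other letters to `1`, only the power of `e` between `a`
and `b` decides whether the value is `a * b`. The order of `s` and `t` must already be known to
agree in both words. -/
theorem Models.between (h : Models M u v) (a e b : M)
    (hab : ∀ i j k, e ^ i * a * e ^ j * b * e ^ k = a * b ↔ j = 0)
    (hu : InvRqXY u v) {s x t : ℕ} (hs : Lin u s) (ht : Lin u t) :
    [s, x, t].Sublist u ↔ [s, x, t].Sublist v := by
  have hs' := (hu.lin s).1 hs
  have ht' := (hu.lin t).1 ht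
  by_cases hne : s = t ∨ s = x ∨ t = x
  · simp [triple_false_left hs hne ht, triple_false_left hs' hne ht']
  obtain ⟨hst, hsx, htx⟩ : s ≠ t ∧ s ≠ x ∧ t ≠ x := by tauto
  by_cases hord : [s, t].Sublist u
  · obtain ⟨p, q, r, rfl⟩ := hs.exists_split_pair ht hord
    obtain ⟨p', q', r', rfl⟩ := hs'.exists_split_pair ht' ((hu.order s t hs ht).1 hord)
    have h1 := h fun n => if n = x then e else if n = s then a else if n = t then b else 1
    rw [prod_map_split_pair hs ht hsx.symm htx.symm,
      prod_map_split_pair hs' ht' hsx.symm htx.symm] at h1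
    have h2 := hab (p.count x) (q.count x) (r.count x)
    rw [h1, hab, List.count_eq_zero, List.count_eq_zero] at h2
    rw [between_lin hs ht, between_lin hs' ht']
    tauto
  · have hord' : ¬ [s, t].Sublist v := by rwa [← hu.order s t hs ht]
    exact iff_of_false (fun h => hord (pair_of_triple h)) fun h => hord' (pair_of_triple h)

theorem Models.order (h : Models M u v) (a b : M) (hab : b * a ≠ a * b) (hu : InvRqX u v)
    {s t : ℕ} (hs : Lin u s) (ht : Lin u t) : [s, t].Sublist u ↔ [s, t].Sublist v := by
  have key (u v : List ℕ) (h : Models M u v) (hu : InvRqX u v) (s t : ℕ) (hs : Lin u s)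
      (ht : Lin u t) (hst : [s, t].Sublist u) : [s, t].Sublist v := by
    have hs' := (hu.lin s).1 hs
    have ht' := (hu.lin t).1 ht
    have hne : s ≠ t := by rintro rfl; exact not_pair_self_of_lin hs hst
    rw [hs'.pair_total ht' hne]
    intro hts
    obtain ⟨p, q, r, rfl⟩ := hs.exists_split_pair ht hst
    obtain ⟨p', q', r', rfl⟩ := ht'.exists_split_pair hs' hts
    have h1 := h fun n => if n = s then a else if n = t then b else 1
    obtain ⟨-, ⟨a1, a2, a3⟩, b1, b2, b3⟩ := lin_split_pair hs ht
    obtain ⟨-, ⟨c1, c2, c3⟩, d1, d2, d3⟩ := lin_split_pair ht' hs'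
    have key (l : List ℕ) (hl : s ∉ l) (hl' : t ∉ l) :
        (l.map fun n => if n = s then a else if n = t then b else 1).prod = 1 := by
      refine List.prod_eq_one fun m hm => ?_
      obtain ⟨n, hn, rfl⟩ := List.mem_map.1 hm
      rw [if_neg (by rintro rfl; exact hl hn), if_neg (by rintro rfl; exact hl' hn)]
    simp [key _ a1 b1, key _ a2 b2, key _ a3 b3, key _ d1 c1, key _ d2 c2, key _ d3 c3,
      hne.symm] at h1
    exact hab h1.symm
  exact ⟨key u v h hu s t hs ht, key v u (fun φ => (h φ).symm) hu.symm s t ((hu.lin s).1 hs)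
    ((hu.lin t).1 ht)⟩

end Invariants

/-! ## Identities of the generating monoids -/

theorem pow_eq_of_idem {M : Type*} [Monoid M] {e : M} (h : e * e = e) {k : ℕ} (hk : k ≠ 0) :
    e ^ k = e := by
  obtain ⟨k, rfl⟩ := Nat.exists_eq_succ_of_ne_zero hk
  exact IsIdempotentElem.pow_succ_eq k h

theorem pow_idem_eq_one_iff {M : Type*} [Monoid M] {e : M} (h : e * e = e) (h1 : e ≠ 1) (k : ℕ) :
    e ^ k = 1 ↔ k = 0 := by
  rcases eq_or_ne k 0 with rfl | hk
  · simp
  · simp [pow_eq_of_idem h hk, hk, h1]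

theorem pow_eq_self_iff {M : Type*} [Monoid M] {a : M} (h : a * a * a = a * a) (h1 : a ≠ 1)
    (h2 : a * a ≠ a) (k : ℕ) : a ^ k = a ↔ k = 1 := by
  have key (k : ℕ) : a ^ (k + 2) = a * a := by
    induction k with
    | zero => exact pow_two a
    | succ k ih => rw [show k + 1 + 2 = (k + 2) + 1 by omega, pow_succ, ih, h]
  match k with
  | 0 => simp [h1.symm]
  | 1 => simp
  | k + 2 => simp [key, h2]

instance : Fintype MonA0 := ⟨{.zero, .e, .f, .ef, .one}, fun x => by cases x <;> simp⟩
instance : Fintype MonB0 := ⟨{.zero, .a, .e, .f, .one}, fun x => by cases x <;> simp⟩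
instance : Fintype MonE := ⟨{.zero, .a, .e, .one}, fun x => by cases x <;> simp⟩
instance : Fintype MonQ := ⟨{.zero, .a, .b, .e, .ab, .one}, fun x => by cases x <;> simp⟩

theorem InvE.of_models {u v : List ℕ} (h : Models MonE u v) : InvE u v := by
  have hx : InvRqX u v :=
    ⟨h.mem .e (pow_idem_eq_one_iff rfl (by decide)),
      h.lin .a (pow_eq_self_iff rfl (by decide) (by decide))⟩
  -- Since `ae = a` and `ea = 0`, the element `a` tolerates `e` on its right only.
  refine ⟨hx, fun x s hs => h.before .e .a (fun i j => ?_) hs ((hx.lin s).1 hs)⟩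
  have he : MonE.e * MonE.e = MonE.e := rfl
  rcases eq_or_ne i 0 with rfl | hi <;> rcases eq_or_ne j 0 with rfl | hj
  · simp
  · simp [pow_eq_of_idem he hj]; decide
  · simp [pow_eq_of_idem he hi, hi]
  · simp [pow_eq_of_idem he hi, pow_eq_of_idem he hj, hi]

theorem InvQ.of_models {u v : List ℕ} (h : Models MonQ u v) : InvQ u v := by
  have hx : InvRqX u v :=
    ⟨h.mem .e (pow_idem_eq_one_iff rfl (by decide)),
      h.lin .a (pow_eq_self_iff rfl (by decide) (by decide))⟩
  have he : MonQ.e * MonQ.e = MonQ.e := rfl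
  have hE : InvE u v := by
    refine ⟨hx, fun x s hs => h.before .e .b (fun i j => ?_) hs ((hx.lin s).1 hs)⟩
    rcases eq_or_ne i 0 with rfl | hi <;> rcases eq_or_ne j 0 with rfl | hj
    · simp
    · simp [pow_eq_of_idem he hj]; decide
    · simp [pow_eq_of_idem he hi, hi]
    · simp [pow_eq_of_idem he hi, pow_eq_of_idem he hj, hi]
  -- In `Q` the element `b` detects `e` on its left, `a` detects it on its right, and `ab` detects
  -- it only in the middle.
  refine ⟨⟨hE, fun x s hs => h.after .e .a (fun i j => ?_) hs ((hx.lin s).1 hs)⟩,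
    fun s x t hs ht => h.between .a .e .b (fun i j k => ?_) hE.toInvRqXY hs ht⟩
  · rcases eq_or_ne i 0 with rfl | hi <;> rcases eq_or_ne j 0 with rfl | hj
    · simp
    · simp [pow_eq_of_idem he hj, hj]
    · simp [pow_eq_of_idem he hi]; decide
    · simp [pow_eq_of_idem he hi, pow_eq_of_idem he hj, hj]
  · rcases eq_or_ne i 0 with rfl | hi <;> rcases eq_or_ne j 0 with rfl | hj <;>
      rcases eq_or_ne k 0 with rfl | hk <;> simp [pow_eq_of_idem he, *] <;> decide

theorem exists_split_of_not_pair {x y : ℕ} {w : List ℕ} (hxy : x ≠ y) (h : ¬ [x, y].Sublist w) :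
    ∃ p q, w = p ++ q ∧ x ∉ p ∧ y ∉ q := by
  by_cases hx : x ∈ w
  · obtain ⟨a, b, rfl, ha⟩ := exists_split_of_mem hx
    refine ⟨a, x :: b, rfl, ha, ?_⟩
    rw [pair_sublist_append, pair_sublist_cons] at h
    simp [hxy.symm]; tauto
  · exact ⟨w, [], by simp, hx, by simp⟩

theorem exists_split_of_pair {x y : ℕ} {w : List ℕ} (h : [x, y].Sublist w) :
    ∃ p q r, w = p ++ x :: (q ++ y :: r) := by
  obtain ⟨a, b, rfl, ha, hb⟩ := List.cons_sublist_iff.1 h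
  obtain ⟨a₁, a₂, rfl⟩ := List.append_of_mem ha
  obtain ⟨b₁, b₂, rfl⟩ := List.append_of_mem (List.singleton_sublist.1 hb)
  exact ⟨a₁, a₂ ++ b₁, b₂, by simp⟩

/-- For `x ≠ y`, the assignment `x ↦ f`, `y ↦ e` gives zero exactly when some `x` precedes some `y`,
because `fe = 0` while `ef` is nonzero. For `x = y` the subword `xx` is detected by the nilpotent
element `ef`. -/
theorem InvA0.of_models {u v : List ℕ} (h : Models MonA0 u v) : InvA0 u v := by
  have hmem := h.mem .e (pow_idem_eq_one_iff rfl (by decide))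
  refine ⟨hmem, fun x y => ?_⟩
  rcases eq_or_ne x y with rfl | hxy
  · have h1 := h.lin .ef (pow_eq_self_iff rfl (by decide) (by decide)) x
    rw [lin_iff, lin_iff] at h1
    have h2 := hmem x
    have h3 : ∀ w : List ℕ, [x, x].Sublist w → x ∈ w := fun w hw => mem_left_of_pair hw
    have h4 := h3 u
    have h5 := h3 v
    tauto
  · have key (w : List ℕ) : [x, y].Sublist w ↔
        (w.map fun n => if n = x then MonA0.f else if n = y then .e else 1).prod = .zero := by
      constructor
      · intro hw
        obtain ⟨p, q, r, rfl⟩ := exists_split_of_pair hw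
        have h1 : ∀ a b c : MonA0, a * (.f * (b * (.e * c))) = .zero := by decide
        simp [hxy.symm, h1]
      · intro hw
        by_contra hn
        obtain ⟨p, q, rfl, hp, hq⟩ := exists_split_of_not_pair hxy hn
        rw [List.map_append, List.prod_append,
          prod_map_eq_pow (w := p) (x := y) fun z hz hzy => by
            rw [if_neg (by rintro rfl; exact hp hz), if_neg hzy],
          prod_map_eq_pow (w := q) (x := x) fun z hz hzx => by
            rw [if_neg hzx, if_neg (by rintro rfl; exact hq hz)]] at hw
        simp only [hxy.symm, if_true, if_false] at hw
        revert hw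
        have he : MonA0.e * MonA0.e = MonA0.e := rfl
        have hf : MonA0.f * MonA0.f = MonA0.f := rfl
        rcases eq_or_ne (p.count y) 0 with hi | hi <;> rcases eq_or_ne (q.count x) 0 with hj | hj <;>
          simp only [hi, hj, pow_eq_of_idem he, pow_eq_of_idem hf, pow_zero, ne_eq, not_false_eq_true]
            <;> decide
    rw [key, key, h]

/-! ## Membership of the generating monoids -/

/-- Reversal exchanges the first two identities and, up to renaming, the last two. -/
theorem definedBy_basis_dual : (definedBy basisA0Q : MonoidVariety.{u}).dual = definedBy basisA0Q := by
  have key (M : MonCat.{u}) (hM : M ∈ definedBy basisA0Q) :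
      MonCat.of (M : Type u)ᵐᵒᵖ ∈ definedBy basisA0Q := by
    obtain ⟨h1, h2, h3, h4⟩ := mem_basis.1 hM
    refine mem_basis.2 ⟨?_, ?_, ?_, ?_⟩
    · intro a h
      exact MulOpposite.unop_injective (by simpa [mul_assoc] using h2 a.unop h.unop)
    · intro a h
      exact MulOpposite.unop_injective (by simpa [mul_assoc] using h1 a.unop h.unop)
    · intro a b h t
      exact MulOpposite.unop_injective (by simpa [mul_assoc] using h4 b.unop a.unop t.unop h.unop)
    · intro a b h t
      exact MulOpposite.unop_injective (by simpa [mul_assoc] using h3 b.unop a.unop t.unop h.unop)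
  refine SetLike.ext fun M => ⟨fun hM => ?_, key M⟩
  exact op_op_mem.1 (key _ hM)

theorem dual_le_basis {V : MonoidVariety.{u}} (hV : V ≤ definedBy basisA0Q) :
    V.dual ≤ definedBy basisA0Q :=
  definedBy_basis_dual.{u} ▸ dual_le_dual hV

theorem ulift_mem_basis {M : Type} [Monoid M] (h1 : ∀ a h : M, a * a * h * a = a * h * a)
    (h2 : ∀ a h : M, a * h * a * a = a * h * a)
    (h3 : ∀ a b h t : M, a * b * h * a * t * b = b * a * h * a * t * b)
    (h4 : ∀ a b h t : M, a * h * b * t * a * b = a * h * b * t * b * a) :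
    MonCat.of (ULift.{u} M) ∈ definedBy basisA0Q :=
  mem_basis.2 ⟨fun a h => congrArg ULift.up (h1 a.down h.down),
    fun a h => congrArg ULift.up (h2 a.down h.down),
    fun a b h t => congrArg ULift.up (h3 a.down b.down h.down t.down),
    fun a b h t => congrArg ULift.up (h4 a.down b.down h.down t.down)⟩

theorem varA0_le_basis : varA0.{u} ≤ definedBy basisA0Q :=
  generatedBy_le.2 (ulift_mem_basis (by decide) (by decide)
    (by intro r s; cases r <;> cases s <;> decide)
    (by intro r s; cases r <;> cases s <;> decide))

theorem varB0_le_basis : varB0.{u} ≤ definedBy basisA0Q :=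
  generatedBy_le.2 (ulift_mem_basis (by decide) (by decide)
    (by intro r s; cases r <;> cases s <;> decide)
    (by intro r s; cases r <;> cases s <;> decide))

theorem varE_le_basis : varE.{u} ≤ definedBy basisA0Q :=
  generatedBy_le.2 (ulift_mem_basis (by decide) (by decide)
    (by intro r s; cases r <;> cases s <;> decide)
    (by intro r s; cases r <;> cases s <;> decide))

theorem varQ_le_basis : varQ.{u} ≤ definedBy basisA0Q :=
  generatedBy_le.2 (ulift_mem_basis (by decide) (by decide)
    (by intro r s; cases r <;> cases s <;> decide)
    (by intro r s; cases r <;> cases s <;> decide))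

/-! ## Rees quotients by words without repeated letters -/

section Rees

variable {w : Word}

/-- The class of a word in the Rees quotient. -/
def toRees (w : Word) : Word →* Rees {w} := (reesCon {w}).mk'

theorem toRees_surjective : Function.Surjective (toRees w) := Con.mk'_surjective

theorem toRees_eq {u v : Word} : toRees w u = toRees w v ↔
    u = v ∨ (¬ IsFactorOf {w} u ∧ ¬ IsFactorOf {w} v) :=
  (reesCon {w}).eq

theorem isFactorOf_singleton {u : Word} : IsFactorOf {w} u ↔ u.toList <:+: w.toList := by
  simp only [IsFactorOf, Set.mem_singleton_iff, exists_eq_left]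
  constructor
  · rintro ⟨p, q, h⟩
    exact ⟨p.toList, q.toList, by rw [h]; rfl⟩
  · rintro ⟨p, q, h⟩
    exact ⟨FreeMonoid.ofList p, FreeMonoid.ofList q, FreeMonoid.toList.injective (by rw [← h]; rfl)⟩

theorem toRees_eq_of_isFactor {u v : Word} (hv : v.toList <:+: w.toList) :
    toRees w u = toRees w v ↔ u = v := by
  rw [toRees_eq, isFactorOf_singleton, isFactorOf_singleton]
  tauto

/-- In the Rees quotient by a word without repeated letters, repeated factors are trivial. -/
theorem rees_mul_eq (hw : w.toList.Nodup) {a : Rees {w}} (ha : a ≠ 1) (p q r p' q' r' : Rees {w}) :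
    p * a * q * a * r = p' * a * q' * a * r' := by
  obtain ⟨a, rfl⟩ := toRees_surjective a
  obtain ⟨p, rfl⟩ := toRees_surjective p
  obtain ⟨q, rfl⟩ := toRees_surjective q
  obtain ⟨r, rfl⟩ := toRees_surjective r
  obtain ⟨p', rfl⟩ := toRees_surjective p'
  obtain ⟨q', rfl⟩ := toRees_surjective q'
  obtain ⟨r', rfl⟩ := toRees_surjective r'
  have key (p q r : Word) : ¬ (p * a * q * a * r).toList <:+: w.toList := by
    intro h
    have h1 : a.toList ≠ [] := fun h => ha (by rw [show a = 1 from FreeMonoid.toList.injective h, map_one])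
    obtain ⟨c, l, hc⟩ := List.exists_cons_of_ne_nil h1
    have h2 := h.sublist.nodup hw
    simp only [FreeMonoid.toList_mul, hc] at h2
    simp [List.nodup_append] at h2
  simp only [← map_mul]
  rw [toRees_eq, isFactorOf_singleton, isFactorOf_singleton]
  exact Or.inr ⟨key _ _ _, key _ _ _⟩

theorem varRees_le_basis (hw : w.toList.Nodup) : varRees.{u} {w} ≤ definedBy basisA0Q := by
  refine generatedBy_le.2 (ulift_mem_basis (fun a h => ?_) (fun a h => ?_) (fun a b h t => ?_)
    fun a b h t => ?_)
  · rcases eq_or_ne a 1 with rfl | ha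
    · simp
    · simpa [mul_assoc] using rees_mul_eq hw ha 1 1 (h * a) 1 h 1
  · rcases eq_or_ne a 1 with rfl | ha
    · simp
    · simpa [mul_assoc] using rees_mul_eq hw ha 1 h a 1 h 1
  · rcases eq_or_ne a 1 with rfl | ha
    · simp
    · simpa [mul_assoc] using rees_mul_eq hw ha 1 (b * h) (t * b) b h (t * b)
  · rcases eq_or_ne a 1 with rfl | ha
    · simp
    · simpa [mul_assoc] using rees_mul_eq hw ha 1 (h * b * t) b 1 (h * b * t * b) 1

theorem varRees_eqv_e (hw : w.toList.Nodup) : (varRees.{u} {w}).Eqv [0, 1, 0] [0, 0, 1] := by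
  rw [varRees, eqv_generatedBy]
  refine models_ulift.2 fun φ => ?_
  rcases eq_or_ne (φ 0) 1 with ha | ha
  · simp [ha]
  · simpa [mul_assoc] using rees_mul_eq hw ha 1 (φ 1) 1 1 1 (φ 1)

theorem varRees_eqv_eDual (hw : w.toList.Nodup) : (varRees.{u} {w}).Eqv [0, 1, 0] [1, 0, 0] := by
  rw [varRees, eqv_generatedBy]
  refine models_ulift.2 fun φ => ?_
  rcases eq_or_ne (φ 0) 1 with ha | ha
  · simp [ha]
  · simpa [mul_assoc] using rees_mul_eq hw ha 1 (φ 1) 1 (φ 1) 1 1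

theorem varRees_x_comm : (varRees.{u} {x}).Eqv [0, 1] [1, 0] := by
  rw [varRees, eqv_generatedBy]
  refine models_ulift.2 fun φ => ?_
  rcases eq_or_ne (φ 0) 1 with ha | ha
  · simp [ha]
  rcases eq_or_ne (φ 1) 1 with hb | hb
  · simp [hb]
  obtain ⟨a, ha'⟩ := toRees_surjective (φ 0)
  obtain ⟨b, hb'⟩ := toRees_surjective (φ 1)
  rw [← ha'] at ha
  rw [← hb'] at hb
  have ha2 : a.toList ≠ [] := fun h => ha (by rw [show a = 1 from FreeMonoid.toList.injective h, map_one])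
  have hb2 : b.toList ≠ [] := fun h => hb (by rw [show b = 1 from FreeMonoid.toList.injective h, map_one])
  have key (u v : Word) (hu : u.toList ≠ []) (hv : v.toList ≠ []) :
      ¬ (u * v).toList <:+: x.toList := by
    intro h
    have h1 := h.length_le
    rw [FreeMonoid.toList_mul, List.length_append, show x.toList.length = 1 from rfl] at h1
    have := List.length_pos_iff.2 hu
    have := List.length_pos_iff.2 hv
    omega
  simp only [List.map_cons, List.map_nil, List.prod_cons, List.prod_nil, mul_one, ← ha', ← hb',
    ← map_mul]
  rw [toRees_eq, isFactorOf_singleton, isFactorOf_singleton]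
  exact Or.inr ⟨key _ _ ha2 hb2, key _ _ hb2 ha2⟩

theorem varRees_one_idem : (varRees.{u} {1}).Eqv [0] [0, 0] := by
  rw [varRees, eqv_generatedBy]
  refine models_ulift.2 fun φ => ?_
  rcases eq_or_ne (φ 0) 1 with ha | ha
  · simp [ha]
  obtain ⟨a, ha'⟩ := toRees_surjective (φ 0)
  rw [← ha'] at ha
  have ha2 : a.toList ≠ [] := fun h => ha (by rw [show a = 1 from FreeMonoid.toList.injective h, map_one])
  simp only [List.map_cons, List.map_nil, List.prod_cons, List.prod_nil, mul_one, ← ha', ← map_mul]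
  rw [toRees_eq, isFactorOf_singleton, isFactorOf_singleton]
  simp [ha2]

theorem length_x_pow (k : ℕ) : (x ^ k).length = k := by
  induction k with
  | zero => rfl
  | succ k ih => rw [pow_succ, FreeMonoid.length_mul, ih, x, FreeMonoid.length_of]

theorem toRees_pow_eq_one {k : ℕ} : toRees w x ^ k = 1 ↔ k = 0 := by
  rw [← map_pow, ← map_one (toRees w), toRees_eq_of_isFactor (v := 1) List.nil_infix]
  refine ⟨fun h => ?_, by rintro rfl; rfl⟩
  simpa [length_x_pow] using congrArg FreeMonoid.length h

theorem toRees_pow_eq_self (hw : 0 ∈ w.toList) {k : ℕ} : toRees w x ^ k = toRees w x ↔ k = 1 := by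
  rw [← map_pow, toRees_eq_of_isFactor]
  · refine ⟨fun h => ?_, by rintro rfl; simp⟩
    have := congrArg FreeMonoid.length h
    rwa [length_x_pow, x, FreeMonoid.length_of] at this
  · obtain ⟨a, b, h⟩ := List.append_of_mem hw
    exact ⟨a, b, by rw [h]; simp [x]⟩

theorem InvRqX.of_models (hw : 0 ∈ w.toList) {u v : List ℕ} (h : Models (Rees {w}) u v) :
    InvRqX u v :=
  ⟨h.mem _ fun _ => toRees_pow_eq_one, h.lin _ fun _ => toRees_pow_eq_self hw⟩

theorem InvRqXY.of_models {u v : List ℕ} (h : Models (Rees {x * y}) u v) : InvRqXY u v := by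
  have hx := InvRqX.of_models (w := x * y) (by decide) h
  refine ⟨hx, fun s t hs ht => h.order (toRees _ x) (toRees _ y) ?_ hx hs ht⟩
  rw [← map_mul, ← map_mul, Ne, toRees_eq_of_isFactor List.infix_rfl]
  intro h
  exact absurd (congrArg FreeMonoid.toList h) (by decide)

end Rees

/-! ## Solutions of the word problems -/

theorem eqv_mono {V U : MonoidVariety.{u}} (h : V ≤ U) {u v : List ℕ} (huv : U.Eqv u v) : V.Eqv u v :=
  le_iff_eqv.1 h u v huv

theorem models_of_generatedBy_le {V : MonoidVariety.{u}} {M : Type} [Monoid M]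
    (hM : generatedBy (MonCat.of (ULift.{u} M)) ≤ V) {u v : List ℕ} (h : V.Eqv u v) : Models M u v :=
  models_ulift.1 (h _ (generatedBy_le.1 hM))

theorem invEDual_iff {u v : List ℕ} : InvEDual u v ↔ InvE u.reverse v.reverse := by
  have key (w : List ℕ) (a b : ℕ) : [a, b].Sublist w.reverse ↔ [b, a].Sublist w := by
    rw [← List.reverse_sublist]; simp
  have hlin (w : List ℕ) (a : ℕ) : Lin w.reverse a ↔ Lin w a := by simp [Lin]
  constructor
  · intro h
    refine ⟨⟨by simpa using h.mem, by simpa [hlin] using h.lin⟩, fun x s hs => ?_⟩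
    rw [key, key]
    exact h.after x s ((hlin _ _).1 hs)
  · intro h
    refine ⟨⟨by simpa using h.mem, by simpa [hlin] using h.lin⟩, fun x s hs => ?_⟩
    rw [← key u x s, ← key v x s]
    exact h.before x s ((hlin _ _).2 hs)

section Sound

variable {V : MonoidVariety.{u}} {u v : List ℕ}

theorem InvA0.of_eqv (hV : varA0 ≤ V) (h : V.Eqv u v) : InvA0 u v :=
  .of_models (models_of_generatedBy_le hV h)

theorem InvQ.of_eqv (hV : varQ ≤ V) (h : V.Eqv u v) : InvQ u v :=
  .of_models (models_of_generatedBy_le hV h)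

theorem InvE.of_eqv (hV : varE ≤ V) (h : V.Eqv u v) : InvE u v :=
  .of_models (models_of_generatedBy_le hV h)

theorem InvEDual.of_eqv (hV : varE.dual ≤ V) (h : V.Eqv u v) : InvEDual u v :=
  invEDual_iff.2 (.of_eqv le_rfl (eqv_dual.1 (eqv_mono hV h)))

theorem InvRqXY.of_eqv (hV : varRees {x * y} ≤ V) (h : V.Eqv u v) : InvRqXY u v :=
  .of_models (models_of_generatedBy_le hV h)

theorem InvRqX.of_eqv (hV : varRees {x} ≤ V) (h : V.Eqv u v) : InvRqX u v :=
  .of_models (by decide) (models_of_generatedBy_le hV h)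

theorem mem_iff_of_eqv (hV : varRees {1} ≤ V) (h : V.Eqv u v) (z : ℕ) : z ∈ u ↔ z ∈ v :=
  (models_of_generatedBy_le hV h).mem _ (fun _ => toRees_pow_eq_one) z

end Sound

/-! ### Completeness of the invariants -/

section Complete

variable {V : MonoidVariety.{u}} {u v : List ℕ}

/-- The identities of `V` itself may violate the invariants, so `eqv_of_invQ` is applied to the
largest variety that satisfies the assumed identities. It contains `Q` and `A₀`, which gives
soundness, and its identities pass down to `V`. Several results below use the same device. -/
theorem eqv_of_invQ_invA0 (hV : V ≤ definedBy basisA0Q) (hQ : InvQ u v) (hA : InvA0 u v) :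
    V.Eqv u v :=
  eqv_mono hV (eqv_of_invQ le_rfl (fun _ _ => .of_eqv varQ_le_basis)
    (Or.inr fun _ _ => .of_eqv varA0_le_basis) hQ (Or.inr hA))

theorem varQ_eqv : varQ.{u}.Eqv [0, 0, 1, 1] [0, 1, 0, 1] := by
  rw [varQ, eqv_generatedBy]
  refine models_ulift.2 fun φ => ?_
  have : ∀ r s : MonQ, r * (r * (s * s)) = r * (s * (r * s)) := by decide
  simpa using this _ _

theorem varE_eqv : varE.{u}.Eqv [0, 1, 0] [0, 0, 1] := by
  rw [varE, eqv_generatedBy]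
  refine models_ulift.2 fun φ => ?_
  have : ∀ r s : MonE, r * (s * r) = r * (r * s) := by decide
  simpa using this _ _

theorem varA0_eqv : varA0.{u}.Eqv [0, 1, 0, 2, 0] [0, 1, 2, 0] := by
  rw [varA0, eqv_generatedBy]
  refine models_ulift.2 fun φ => ?_
  have : ∀ r s t : MonA0, r * (s * (r * (t * r))) = r * (s * (t * r)) := by decide
  simpa using this _ _ _

theorem varB0_eqv : varB0.{u}.Eqv [0, 1, 0, 2, 0] [0, 1, 2, 0] := by
  rw [varB0, eqv_generatedBy]
  refine models_ulift.2 fun φ => ?_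
  have : ∀ r s t : MonB0, r * (s * (r * (t * r))) = r * (s * (t * r)) := by decide
  simpa using this _ _ _

theorem varB0_eqv_comm : varB0.{u}.Eqv [0, 0, 1, 1] [0, 1, 0, 1] := by
  rw [varB0, eqv_generatedBy]
  refine models_ulift.2 fun φ => ?_
  have : ∀ r s : MonB0, r * (r * (s * s)) = r * (s * (r * s)) := by decide
  simpa using this _ _

theorem eqv_of_invQ_comm (hV : V ≤ definedBy basisA0Q) (hC : V.Eqv [0, 0, 1, 1] [0, 1, 0, 1])
    (hQ : InvQ u v) : V.Eqv u v := by
  have hVU : V ≤ definedBy basisA0Q ⊓ single [0, 0, 1, 1] [0, 1, 0, 1] := le_inf hV (le_single.2 hC)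
  have hU := le_single.1
    (inf_le_right : definedBy basisA0Q ⊓ single.{u} [0, 0, 1, 1] [0, 1, 0, 1] ≤ _)
  exact eqv_mono hVU (eqv_of_invQ inf_le_left
    (fun _ _ => .of_eqv (le_inf varQ_le_basis (le_single.2 varQ_eqv))) (Or.inl hU) hQ (Or.inl hU))

/-- The identity `xyxzx ≈ xyzx` deletes the middle one of three occurrences, shortening the word. -/
theorem Minimal.triple_free (hC : V.Eqv [0, 1, 0, 2, 0] [0, 1, 2, 0]) {w : List ℕ}
    (hw : V.Minimal w) (z : ℕ) : ¬ [z, z, z].Sublist w := by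
  intro h
  obtain ⟨p, q, rfl, hp, hq⟩ := List.cons_sublist_iff.1 h
  obtain ⟨p, p', rfl⟩ := List.append_of_mem hp
  obtain ⟨q, q', r, rfl⟩ := exists_split_of_pair hq
  have := hw (p ++ (z :: ((p' ++ q) ++ (q' ++ z :: r)))) ?_
  · simp at this
  · intro M hM φ
    have := hC M hM fun n => if n = 0 then φ z else if n = 1 then ((p' ++ q).map φ).prod else
      (q'.map φ).prod
    simp at this ⊢
    simp only [← mul_assoc] at this ⊢
    have := congrArg (fun m => (p.map φ).prod * m * (r.map φ).prod) this
    simpa only [mul_assoc] using this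

theorem InvB0.toInvQ_of_triple_free (h : InvB0 u v) (hu : ∀ z, ¬ [z, z, z].Sublist u)
    (hv : ∀ z, ¬ [z, z, z].Sublist v) : InvQ u v := by
  refine ⟨h, fun s z t hs ht => ?_⟩
  have hs' := (h.lin s).1 hs
  have ht' := (h.lin t).1 ht
  by_cases hne : s = t ∨ s = z ∨ t = z
  · simp [triple_false_left hs hne ht, triple_false_left hs' hne ht']
  obtain ⟨hst, hsx, htx⟩ : s ≠ t ∧ s ≠ z ∧ t ≠ z := by tauto
  by_cases hord : [s, t].Sublist u
  · obtain ⟨p, q, r, rfl⟩ := hs.exists_split_pair ht hord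
    obtain ⟨p', q', r', rfl⟩ := hs'.exists_split_pair ht' ((h.before s t ht).1 hord)
    have key {p q r : List ℕ} (hs : Lin (p ++ s :: (q ++ t :: r)) s)
        (ht : Lin (p ++ s :: (q ++ t :: r)) t) (hu : ¬ [z, z, z].Sublist (p ++ s :: (q ++ t :: r))) :
        (z ∈ p ↔ [z, s].Sublist (p ++ s :: (q ++ t :: r))) ∧
        (z ∈ q ∨ z ∈ r ↔ [s, z].Sublist (p ++ s :: (q ++ t :: r))) ∧
        (z ∈ p ∨ z ∈ q ↔ [z, t].Sublist (p ++ s :: (q ++ t :: r))) ∧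
        (z ∈ r ↔ [t, z].Sublist (p ++ s :: (q ++ t :: r))) ∧ ¬ (z ∈ p ∧ z ∈ q ∧ z ∈ r) := by
      have h1 := lin_split.1 hs
      have h2 : t ∉ p ++ s :: q ∧ t ∉ r := by rw [← lin_split]; simpa using ht
      rw [before_lin h1.1 h1.2, after_lin h1.1 h1.2,
        show p ++ s :: (q ++ t :: r) = (p ++ s :: q) ++ t :: r by simp, before_lin h2.1 h2.2,
        after_lin h2.1 h2.2]
      refine ⟨Iff.rfl, by simp [htx.symm], by simp [hsx.symm], Iff.rfl, fun ⟨a, b, c⟩ => hu ?_⟩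
      simp [triple_sublist_append, triple_sublist_cons, pair_sublist_append, a, b, c]
    have k1 := key hs ht (hu z)
    have k2 := key hs' ht' (hv z)
    rw [← h.before z s hs, ← h.before z t ht, ← h.after z s hs, ← h.after z t ht] at k2
    rw [between_lin hs ht, between_lin hs' ht']
    obtain ⟨a₁, a₂, a₃, a₄, a₅⟩ := k1
    obtain ⟨b₁, b₂, b₃, b₄, b₅⟩ := k2
    rw [← a₁] at b₁
    rw [← a₂] at b₂
    rw [← a₃] at b₃
    rw [← a₄] at b₄
    clear a₁ a₂ a₃ a₄ key hne
    constructor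
    · intro hq
      -- If only one of the words has `z` between `s` and `t`, then the other must have it before
      -- `s` and after `t` to match the first and last occurrences. The same then holds for the
      -- first word, which contains `z` three times.
      by_contra hq'
      simp only [hq, hq', or_true, true_or, false_or, or_false, true_and, iff_true] at *
      exact a₅ ⟨b₁.1 b₃, b₄.1 b₂⟩
    · intro hq'
      by_contra hq
      simp only [hq, hq', or_true, true_or, false_or, or_false, true_and, true_iff] at *
      exact b₅ ⟨b₁.2 b₃, b₄.2 b₂⟩
  · have hord' : ¬ [s, t].Sublist v := by rwa [← h.before s t ht]
    exact iff_of_false (fun h => hord (pair_of_triple h)) fun h => hord' (pair_of_triple h)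

theorem exists_triple_free (w : List ℕ) (hV : V ≤ definedBy basisA0Q)
    (hC : V.Eqv [0, 1, 0, 2, 0] [0, 1, 2, 0]) :
    ∃ w', V.Eqv w w' ∧ InvA0 w w' ∧ ∀ z, ¬ [z, z, z].Sublist w' := by
  obtain ⟨w', h, hmin⟩ := exists_minimal (definedBy basisA0Q ⊓ single [0, 1, 0, 2, 0] [0, 1, 2, 0]) w
  exact ⟨w', eqv_mono (le_inf hV (le_single.2 hC)) h,
    .of_eqv (le_inf varA0_le_basis (le_single.2 varA0_eqv)) h,
    hmin.triple_free (le_single.1 inf_le_right)⟩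

theorem eqv_of_invA0 (hV : V ≤ definedBy basisA0Q) (hC : V.Eqv [0, 1, 0, 2, 0] [0, 1, 2, 0])
    (h : InvA0 u v) : V.Eqv u v := by
  obtain ⟨u', hu, hu', hu''⟩ := exists_triple_free u hV hC
  obtain ⟨v', hv, hv', hv''⟩ := exists_triple_free v hV hC
  have hI := hu'.symm.trans (h.trans hv')
  exact hu.trans ((eqv_of_invQ_invA0 hV (hI.toInvB0.toInvQ_of_triple_free hu'' hv'') hI).trans hv.symm)

theorem eqv_of_invB0 (hV : V ≤ definedBy basisA0Q) (hC : V.Eqv [0, 1, 0, 2, 0] [0, 1, 2, 0])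
    (hC' : V.Eqv [0, 0, 1, 1] [0, 1, 0, 1]) (h : InvB0 u v) : V.Eqv u v := by
  obtain ⟨u', hu, hu', hu''⟩ := exists_triple_free u hV hC
  obtain ⟨v', hv, hv', hv''⟩ := exists_triple_free v hV hC
  have hI := hu'.toInvB0.symm.trans (h.trans hv'.toInvB0)
  exact hu.trans ((eqv_of_invQ_comm hV hC' (hI.toInvQ_of_triple_free hu'' hv'')).trans hv.symm)

/-- By `xyx ≈ xxy` any later `z` moves back to the initial `zz`, where the resulting cube contracts.
-/
theorem eqv_cons_cons_filter (hV : V ≤ definedBy basisA0Q) (hC : V.Eqv [0, 1, 0] [0, 0, 1]) (z : ℕ)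
    (l : List ℕ) : V.Eqv (z :: z :: l) (z :: z :: l.filter (· ≠ z)) := by
  induction l using List.reverseRecOn with
  | nil => exact Eqv.refl _ _
  | append_singleton l a ih =>
    have h1 : V.Eqv (z :: z :: (l ++ [a])) (z :: z :: (l.filter (· ≠ z) ++ [a])) := by
      simpa using ih.append_right [a]
    refine h1.trans ?_
    rcases eq_or_ne a z with rfl | ha
    · have h2 : V.Eqv (a :: a :: (l.filter (· ≠ a) ++ [a])) (a :: a :: a :: l.filter (· ≠ a)) := by
        refine Eqv.cons a fun M hM φ => ?_
        simpa using hC M hM fun n => if n = 0 then φ a else ((l.filter (· ≠ a)).map φ).prod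
      have h3 := contract (p := [a]) (x := a) (q := l.filter (· ≠ a)) hV (by simp)
      simpa using h2.trans h3
    · simp [ha, Eqv.refl]

/-- The normal form collects all occurrences of a repeated letter into a square at its first
occurrence. -/
theorem exists_e_form (hV : V ≤ definedBy basisA0Q) (hC : V.Eqv [0, 1, 0] [0, 0, 1]) (w : List ℕ) :
    ∃ w', V.Eqv w w' ∧ (∀ z ∈ w', z ∈ w) ∧ ∀ z s, s ≠ z → ¬ [z, s, z].Sublist w' := by
  induction hn : w.length using Nat.strong_induction_on generalizing w with
  | _ n ih =>
    rcases w with _ | ⟨a, l⟩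
    · exact ⟨[], Eqv.refl _ _, by simp, by simp⟩
    by_cases ha : a ∈ l
    · have hlen := List.length_filter_le (fun n => decide (n ≠ a)) l
      obtain ⟨l', h1, h2, h3⟩ := ih _ (by simp at hn; omega) (l.filter (· ≠ a)) rfl
      refine ⟨a :: a :: l', ?_, fun z hz => ?_, fun z s hs => ?_⟩
      · exact (contract (p := []) hV (Or.inr ha)).symm.trans
          ((eqv_cons_cons_filter hV hC a l).trans ((h1.cons a).cons a))
      · have := h2 z
        simp at hz this ⊢
        tauto
      · have := h2 a
        simp at this
        simp only [triple_sublist_cons, pair_sublist_cons, not_or, not_and]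
        refine ⟨?_, ?_, h3 z s hs⟩
        · rintro rfl
          exact ⟨fun h => absurd h hs, fun h => this (mem_right_of_pair h)⟩
        · rintro rfl h
          exact this (mem_right_of_pair h)
    · obtain ⟨l', h1, h2, h3⟩ := ih _ (by simp at hn; omega) l rfl
      refine ⟨a :: l', h1.cons a, fun z hz => ?_, fun z s hs => ?_⟩
      · have := h2 z
        simp at hz ⊢
        tauto
      · simp only [triple_sublist_cons, not_or, not_and]
        refine ⟨?_, h3 z s hs⟩
        rintro rfl h
        exact ha (h2 _ (mem_right_of_pair h))

/-- In this normal form a letter never lies on both sides of a linear letter, so its position before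
linear letters determines its position after them and its block. -/
theorem InvE.toInvQ (h : InvE u v) (hu : ∀ z s, s ≠ z → ¬ [z, s, z].Sublist u)
    (hv : ∀ z s, s ≠ z → ¬ [z, s, z].Sublist v) : InvQ u v := by
  have key {w : List ℕ} (hw : ∀ z s, s ≠ z → ¬ [z, s, z].Sublist w) {z s : ℕ} (hs : Lin w s) :
      [s, z].Sublist w ↔ z ∈ w ∧ s ≠ z ∧ ¬ [z, s].Sublist w := by
    rcases eq_or_ne s z with rfl | hsz
    · simp [not_pair_self_of_lin hs]
    obtain ⟨p, q, rfl, hp, hq⟩ := hs.exists_split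
    have := hw z s hsz
    simp only [triple_sublist_append, triple_sublist_cons, pair_sublist_cons] at this
    rw [after_lin hp hq, before_lin hp hq]
    simp [hsz, hsz.symm]
    tauto
  refine ⟨⟨h, fun z s hs => ?_⟩, fun s z t hs ht => ?_⟩
  · rw [key hu hs, key hv ((h.lin s).1 hs), h.mem, h.before z s hs]
  · have key2 {w : List ℕ} (hw : ∀ z s, s ≠ z → ¬ [z, s, z].Sublist w) {z s t : ℕ} (hs : Lin w s)
        (ht : Lin w t) : [s, z, t].Sublist w ↔
          [s, t].Sublist w ∧ s ≠ z ∧ [z, t].Sublist w ∧ ¬ [z, s].Sublist w := by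
      by_cases hne : s = t ∨ s = z ∨ t = z
      · refine iff_of_false (triple_false_left hs hne ht) ?_
        rcases hne with rfl | rfl | rfl
        · exact fun h => not_pair_self_of_lin hs h.1
        · simp
        · exact fun h => not_pair_self_of_lin ht h.2.2.1
      obtain ⟨hst, hsx, htx⟩ : s ≠ t ∧ s ≠ z ∧ t ≠ z := by tauto
      refine ⟨fun h => ⟨pair_of_triple h, hsx, (show [z, t].Sublist [s, z, t] by simp).trans h,
        ((key hw hs).1 ((show [s, z].Sublist [s, z, t] by simp).trans h)).2.2⟩, fun ⟨h1, _, h2, h3⟩ => ?_⟩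
      obtain ⟨p, q, r, rfl⟩ := hs.exists_split_pair ht h1
      have h4 := lin_split.1 hs
      have h5 : t ∉ p ++ s :: q ∧ t ∉ r := by rw [← lin_split]; simpa using ht
      rw [before_lin h4.1 h4.2] at h3
      rw [show p ++ s :: (q ++ t :: r) = (p ++ s :: q) ++ t :: r by simp, before_lin h5.1 h5.2] at h2
      rw [between_lin hs ht]
      simpa [h3, hsx.symm] using h2
    rw [key2 hu hs ht, key2 hv ((h.lin s).1 hs) ((h.lin t).1 ht), h.before s t ht, h.before z t ht,
      h.before z s hs]

theorem comm_of_e (hC : V.Eqv [0, 1, 0] [0, 0, 1]) : V.Eqv [0, 0, 1, 1] [0, 1, 0, 1] := by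
  have h1 : V.Eqv [0, 1, 0, 1] [0, 0, 1, 1] := hC.append_right [1]
  exact h1.symm

theorem eqv_of_invE (hV : V ≤ definedBy basisA0Q) (hC : V.Eqv [0, 1, 0] [0, 0, 1]) (h : InvE u v) :
    V.Eqv u v := by
  have hVU : V ≤ definedBy basisA0Q ⊓ single [0, 1, 0] [0, 0, 1] := le_inf hV (le_single.2 hC)
  have hU := le_single.1 (inf_le_right : definedBy basisA0Q ⊓ single.{u} [0, 1, 0] [0, 0, 1] ≤ _)
  obtain ⟨u', hu, -, hu'⟩ := exists_e_form inf_le_left hU u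
  obtain ⟨v', hv, -, hv'⟩ := exists_e_form inf_le_left hU v
  have hE := le_inf varE_le_basis (le_single.2 varE_eqv.{u})
  have hI : InvE u' v' := (InvE.of_eqv hE hu).symm.trans (h.trans (.of_eqv hE hv))
  exact eqv_mono hVU (hu.trans ((eqv_of_invQ_comm inf_le_left (comm_of_e hU)
    (hI.toInvQ hu' hv')).trans hv.symm))

theorem eqv_of_invEDual (hV : V ≤ definedBy basisA0Q) (hC : V.Eqv [0, 1, 0] [1, 0, 0])
    (h : InvEDual u v) : V.Eqv u v := by
  have := eqv_of_invE (dual_le_basis hV) (eqv_dual.2 hC) (invEDual_iff.1 h)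
  simpa using eqv_dual.1 this

/-- The two identities give `xxy ≈ yxx`, so squares are central. All repeated letters move to the
front as squares, followed by the linear letters. -/
theorem exists_xy_form (hV : V ≤ definedBy basisA0Q) (hC : V.Eqv [0, 1, 0] [0, 0, 1])
    (hC' : V.Eqv [0, 1, 0] [1, 0, 0]) (w : List ℕ) :
    ∃ w', V.Eqv w w' ∧ (∀ z ∈ w', z ∈ w) ∧
      ∀ z s, ¬ Lin w' z → Lin w' s → ¬ [s, z].Sublist w' := by
  induction hn : w.length using Nat.strong_induction_on generalizing w with
  | _ n ih =>
    by_cases hw : ∃ z ∈ w, ¬ Lin w z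
    · obtain ⟨z, hz, hlin⟩ := hw
      obtain ⟨a, b, rfl, ha⟩ := exists_split_of_mem hz
      have hb : z ∈ b := (not_lin_split.1 hlin).resolve_left ha
      have hlen := List.length_filter_le (fun n => decide (n ≠ z)) (a ++ b)
      obtain ⟨l', h1, h2, h3⟩ := ih _ (by simp at hn hlen ⊢; omega) ((a ++ b).filter (· ≠ z)) rfl
      have hzl : z ∉ l' := fun h => by simpa using h2 z h
      have hl (r : ℕ) (hr : r ≠ z) : Lin (z :: z :: l') r ↔ Lin l' r := by
        simp [Lin, hr.symm]
      refine ⟨z :: z :: l', ?_, fun r hr => ?_, fun r s hr hs hsub => ?_⟩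
      · have h4 : V.Eqv (a ++ z :: z :: b) (z :: z :: (a ++ b)) := by
          have : V.Eqv (a ++ [z, z]) (z :: z :: a) := fun M hM φ => by
            simpa using ((hC.symm.trans hC') M hM
              fun n => if n = 0 then φ z else (a.map φ).prod).symm
          simpa using this.append_right b
        exact (contract hV (Or.inr hb)).symm.trans (h4.trans
          ((eqv_cons_cons_filter hV hC z _).trans ((h1.cons z).cons z)))
      · have := h2 r
        simp at hr this ⊢
        tauto
      · have hsz : s ≠ z := by
          rintro rfl
          exact not_pair_self_of_lin hs (by simp)
        simp only [pair_sublist_cons, hsz, false_and, false_or] at hsub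
        have hrz : r ≠ z := by rintro rfl; exact hzl (mem_right_of_pair hsub)
        exact h3 r s (by rwa [← hl r hrz]) ((hl s hsz).1 hs) hsub
    · push Not at hw
      exact ⟨w, Eqv.refl _ _, fun _ h => h, fun z s hz _ h => hz (hw z (mem_right_of_pair h))⟩

theorem InvRqXY.toInvE (h : InvRqXY u v) (hu : ∀ z s, ¬ Lin u z → Lin u s → ¬ [s, z].Sublist u)
    (hv : ∀ z s, ¬ Lin v z → Lin v s → ¬ [s, z].Sublist v) : InvE u v := by
  refine ⟨h.toInvRqX, fun z s hs => ?_⟩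
  have key {w : List ℕ} (hw : ∀ z s, ¬ Lin w z → Lin w s → ¬ [s, z].Sublist w) (hs : Lin w s)
      (hz : ¬ Lin w z) : [z, s].Sublist w ↔ z ∈ w := by
    have hsz : s ≠ z := by rintro rfl; exact hz hs
    have h1 := hw z s hz hs
    obtain ⟨p, q, rfl, hp, hq⟩ := hs.exists_split
    rw [after_lin hp hq] at h1
    rw [before_lin hp hq]
    simp [h1, hsz.symm]
  by_cases hz : Lin u z
  · exact h.order z s hz hs
  · rw [key hu hs hz, key hv ((h.lin s).1 hs) (by rwa [← h.lin]), h.mem]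

theorem eqv_of_invRqXY (hV : V ≤ definedBy basisA0Q) (hC : V.Eqv [0, 1, 0] [0, 0, 1])
    (hC' : V.Eqv [0, 1, 0] [1, 0, 0]) (h : InvRqXY u v) : V.Eqv u v := by
  let U : MonoidVariety.{u} :=
    definedBy basisA0Q ⊓ (single [0, 1, 0] [0, 0, 1] ⊓ single [0, 1, 0] [1, 0, 0])
  have hVU : V ≤ U := le_inf hV (le_inf (le_single.2 hC) (le_single.2 hC'))
  have hU : U.Eqv [0, 1, 0] [0, 0, 1] := le_single.1 (inf_le_right.trans inf_le_left)
  have hU' : U.Eqv [0, 1, 0] [1, 0, 0] := le_single.1 (inf_le_right.trans inf_le_right)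
  obtain ⟨u', hu, -, hu'⟩ := exists_xy_form inf_le_left hU hU' u
  obtain ⟨v', hv, -, hv'⟩ := exists_xy_form inf_le_left hU hU' v
  have hd : (x * y).toList.Nodup := by decide
  have hE : varRees {x * y} ≤ U := le_inf (varRees_le_basis hd)
    (le_inf (le_single.2 (varRees_eqv_e hd)) (le_single.2 (varRees_eqv_eDual hd)))
  have h1 := InvRqXY.of_eqv hE hu.symm
  have hI : InvRqXY u' v' := h1.trans (h.trans (.of_eqv hE hv))
  exact eqv_mono hVU (hu.trans ((eqv_of_invE inf_le_left hU (hI.toInvE hu' hv')).trans hv.symm))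

theorem eqv_of_comm_of_pow (hC : V.Eqv [0, 1] [1, 0]) (hmem : ∀ z, z ∈ u ↔ z ∈ v)
    (hpow : ∀ z ∈ u, V.Eqv (List.replicate (u.count z) 0) (List.replicate (v.count z) 0)) :
    V.Eqv u v := by
  intro M hM φ
  let _ : CommMonoid M := { (inferInstance : Monoid M) with
    mul_comm := fun a b => by simpa using hC M hM fun n => if n = 0 then a else b }
  rw [Finset.prod_list_map_count, Finset.prod_list_map_count,
    show u.toFinset = v.toFinset by ext z; simp [hmem]]
  refine Finset.prod_congr rfl fun z hz => ?_
  simpa using hpow z (by rw [hmem]; simpa using hz) M hM fun _ => φ z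

theorem eqv_of_invRqX (hV : V ≤ definedBy basisA0Q) (hC : V.Eqv [0, 1] [1, 0]) (h : InvRqX u v) :
    V.Eqv u v := by
  refine eqv_of_comm_of_pow hC h.mem fun z hz M hM φ => ?_
  have h1 : ∀ k, φ 0 ^ (k + 2) = φ 0 ^ 2 := fun k => by
    induction k with
    | zero => rfl
    | succ k ih =>
      rw [show k + 1 + 2 = k + 2 + 1 by omega, pow_succ, ih]
      simpa [pow_succ] using (mem_basis.1 (hV hM)).1 (φ 0) 1
  have h2 := h.lin z
  have h3 := List.one_le_count_iff.2 hz
  have h4 := List.one_le_count_iff.2 ((h.mem z).1 hz)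
  simp only [List.map_replicate, List.prod_replicate]
  simp only [Lin] at h2
  rcases Nat.lt_or_ge (u.count z) 2 with h5 | h5
  · rw [h2.1 (by omega), show u.count z = 1 by omega]
  · obtain ⟨k, hk⟩ := Nat.exists_eq_add_of_le' h5
    obtain ⟨l, hl⟩ := Nat.exists_eq_add_of_le' (show 2 ≤ v.count z by omega)
    rw [hk, hl, h1 k, h1 l]

/-- With `h = t = 1` and idempotency, the last two basis identities become `ab = bab` and `ab =
aba`, so `ab = bab = ba`. -/
theorem comm_of_idem (hV : V ≤ definedBy basisA0Q) (hC : V.Eqv [0] [0, 0]) : V.Eqv [0, 1] [1, 0] := by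
  intro M hM φ
  have hi (a : M) : a * a = a := by simpa using (hC M hM fun _ => a).symm
  obtain ⟨-, -, h3, h4⟩ := mem_basis.1 (hV hM)
  have e1 (a b : M) : a * b = b * a * b := by
    have := h3 a b 1 1
    simp only [mul_one] at this
    rwa [mul_assoc (a * b), hi, mul_assoc b, hi] at this
  have e2 (a b : M) : a * b = a * b * a := by
    have := h4 a b 1 1
    simp only [mul_one] at this
    rwa [mul_assoc (a * b), hi, mul_assoc a b b, hi] at this
  have e3 : φ 0 * φ 1 = φ 1 * φ 0 := (e1 _ _).trans (e2 _ _).symm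
  simpa using e3

theorem eqv_of_mem_iff (hV : V ≤ definedBy basisA0Q) (hC : V.Eqv [0] [0, 0])
    (h : ∀ z, z ∈ u ↔ z ∈ v) : V.Eqv u v := by
  refine eqv_of_comm_of_pow (comm_of_idem hV hC) h fun z hz M hM φ => ?_
  have hi : φ 0 * φ 0 = φ 0 := by simpa using (hC M hM φ).symm
  have h3 := List.one_le_count_iff.2 hz
  have h4 := List.one_le_count_iff.2 ((h z).1 hz)
  simp only [List.map_replicate, List.prod_replicate]
  rw [pow_eq_of_idem hi (by omega), pow_eq_of_idem hi (by omega)]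

theorem le_trivial (hC : V.Eqv [0] []) : V ≤ trivial := by
  intro M hM
  have h1 (a : M) : a = 1 := by simpa using hC M hM fun _ => a
  exact (⟨fun a b => (h1 a).trans (h1 b).symm⟩ : Subsingleton M)

end Complete

/-! ## Subvarieties that do not contain a given generator -/

section Exclusion

variable {V : MonoidVariety.{u}}

theorem exists_eqv_of_not_le {V U : MonoidVariety.{u}} (h : ¬ U ≤ V) :
    ∃ u v, V.Eqv u v ∧ ¬ U.Eqv u v := by
  rw [le_iff_eqv] at h
  push Not at h
  exact h

theorem eqv_of_trivial (h : V.Eqv [0] []) (u v : List ℕ) : V.Eqv u v := fun M hM φ => by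
  have h1 (a : M) : a = 1 := by simpa using h M hM fun _ => a
  rw [h1 (u.map φ).prod, h1 (v.map φ).prod]

/-- Some identity of `V` changes the set of letters, so every element has a positive power equal to
`1`. Cancelling in `a³ = a²`, which the basis implies, leaves `a = 1`. -/
theorem eqv_nil_of_not_le (hV : V ≤ definedBy basisA0Q) (h : ¬ varRees {1} ≤ V) : V.Eqv [0] [] := by
  obtain ⟨u, v, huv, hne⟩ := exists_eqv_of_not_le h
  have h1 : ¬ ∀ z, z ∈ u ↔ z ∈ v := fun h =>
    hne (eqv_of_mem_iff (varRees_le_basis (by decide)) varRees_one_idem h)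
  intro M hM φ
  have h2 : ∃ k, φ 0 ^ k = 1 ∧ k ≠ 0 := by
    by_contra! hk
    exact h1 ((huv M hM).mem (φ 0) fun k => ⟨hk k, by rintro rfl; simp⟩)
  obtain ⟨k, hk, hk0⟩ := h2
  obtain ⟨k, rfl⟩ := Nat.exists_eq_succ_of_ne_zero hk0
  have h3 : φ 0 * φ 0 * φ 0 = φ 0 * φ 0 := by simpa using (mem_basis.1 (hV hM)).1 (φ 0) 1
  rw [pow_succ] at hk
  have h4 : φ 0 * φ 0 = φ 0 := by
    have := congrArg (φ 0 ^ k * ·) h3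
    simpa only [← mul_assoc, hk, one_mul] using this
  have h5 : φ 0 = 1 := by
    have := congrArg (φ 0 ^ k * ·) h4
    simpa only [← mul_assoc, hk, one_mul] using this
  simpa using h5

theorem eqv_idem_of_not_le (hV : V ≤ definedBy basisA0Q) (h : ¬ varRees {x} ≤ V) :
    V.Eqv [0] [0, 0] := by
  by_cases h1 : varRees {1} ≤ V
  · obtain ⟨u, v, huv, hne⟩ := exists_eqv_of_not_le h
    intro M hM φ
    by_contra hφ
    refine hne (eqv_of_invRqX (varRees_le_basis (by decide)) varRees_x_comm
      ⟨mem_iff_of_eqv h1 huv, ?_⟩)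
    have h3 : φ 0 * φ 0 * φ 0 = φ 0 * φ 0 := by simpa using (mem_basis.1 (hV hM)).1 (φ 0) 1
    -- An element with `a² ≠ a` and `a³ = a²` detects linear letters, so it would make the
    -- separating identity hold in `Rq{x}`.
    refine (huv M hM).lin (φ 0) (pow_eq_self_iff h3 ?_ ?_)
    · intro h; simp [h] at hφ
    · intro h; simp [h] at hφ
  · exact eqv_of_trivial (eqv_nil_of_not_le hV h1) _ _

theorem eqv_comm_of_not_le (hV : V ≤ definedBy basisA0Q) (h : ¬ varRees {x * y} ≤ V) :
    V.Eqv [0, 1] [1, 0] := by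
  by_cases h1 : varRees {x} ≤ V
  · obtain ⟨u, v, huv, hne⟩ := exists_eqv_of_not_le h
    intro M hM φ
    by_contra hφ
    have hd : (x * y).toList.Nodup := by decide
    have hx := InvRqX.of_eqv h1 huv
    exact hne (eqv_of_invRqXY (varRees_le_basis hd) (varRees_eqv_e hd) (varRees_eqv_eDual hd)
      ⟨hx, fun s t hs ht => (huv M hM).order (φ 0) (φ 1) (by simpa [eq_comm] using hφ) hx hs ht⟩)
  · exact comm_of_idem hV (eqv_idem_of_not_le hV h1)

theorem pow_mul_pow {M : MonCat.{u}} (hM : M ∈ definedBy basisA0Q) (a b : M) {i j : ℕ} (hi : i ≠ 0)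
    (hj : j ≠ 0) : a ^ i * b * a ^ j = a * b * a := by
  obtain ⟨h1, h2, -⟩ := mem_basis.1 hM
  obtain ⟨i, rfl⟩ := Nat.exists_eq_succ_of_ne_zero hi
  obtain ⟨j, rfl⟩ := Nat.exists_eq_succ_of_ne_zero hj
  have e1 (b : M) : a ^ (i + 1) * b * a = a * b * a := by
    induction i with
    | zero => simp
    | succ i ih =>
      rw [pow_succ', mul_assoc, mul_assoc, ← mul_assoc _ b a, ih (by simp), ← mul_assoc, ← mul_assoc, h1]
  have e2 (b : M) : a * b * a ^ (j + 1) = a * b * a := by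
    induction j with
    | zero => simp
    | succ j ih => rw [pow_succ, ← mul_assoc, ih (by simp), h2]
  rw [pow_succ a j, ← mul_assoc, mul_assoc (a ^ (i + 1)), e1, ← mul_assoc, mul_assoc, ← pow_succ, e2]

theorem eqv_eDual_of_before (hV : V ≤ definedBy basisA0Q) {u v : List ℕ} (huv : V.Eqv u v)
    (hx : InvRqX u v) {z s : ℕ} (hs : Lin u s) (hu : [z, s].Sublist u) (hv : ¬ [z, s].Sublist v) :
    V.Eqv [0, 1, 0] [1, 0, 0] := by
  intro M hM φ
  have hzs : z ≠ s := by rintro rfl; exact not_pair_self_of_lin hs hu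
  have hzv := (hx.mem z).1 (mem_left_of_pair hu)
  obtain ⟨p, q, rfl, hp, hq⟩ := hs.exists_split
  obtain ⟨p', q', rfl, hp', hq'⟩ := ((hx.lin s).1 hs).exists_split
  rw [before_lin hp hq] at hu
  rw [before_lin hp' hq'] at hv
  have h1 := huv M hM fun n => if n = z then φ 0 else if n = s then φ 1 else 1
  rw [prod_map_lin hp hq hzs, prod_map_lin hp' hq' hzs, List.count_eq_zero.2 hv, pow_zero,
    one_mul] at h1
  have hzq' : z ∈ q' := by simpa [hv, hzs] using hzv
  obtain ⟨k, hk⟩ := Nat.exists_eq_succ_of_ne_zero (mt List.count_eq_zero.1 (not_not.2 hzq'))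
  -- The substitution has produced `xⁱyxʲ = yxᵏ` with `i, k ≥ 1`. Multiplying by `x` on the right
  -- ensures positive exponents on both sides of `y`, so that the left side reduces to `xyx` and the
  -- right side to `yxx`.
  have h2 := congrArg (· * φ 0) h1
  simp only [mul_assoc, ← pow_succ] at h2
  rw [← mul_assoc, pow_mul_pow (hV hM) _ _ (mt List.count_eq_zero.1 (not_not.2 hu)) (by omega), hk] at h2
  have h3 : φ 0 ^ (k + 1 + 1) = φ 0 * φ 0 := by
    rw [pow_succ]
    simpa using pow_mul_pow (hV hM) (φ 0) 1 (i := k + 1) (j := 1) (by omega) (by omega)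
  rw [Nat.succ_eq_add_one, h3] at h2
  simpa [mul_assoc] using h2

theorem eqv_eDual_of_not_le (hV : V ≤ definedBy basisA0Q) (h : ¬ varE ≤ V) :
    V.Eqv [0, 1, 0] [1, 0, 0] := by
  by_cases h1 : varRees {x * y} ≤ V
  · obtain ⟨u, v, huv, hne⟩ := exists_eqv_of_not_le h
    have hx := (InvRqXY.of_eqv h1 huv).toInvRqX
    by_contra hn
    refine hne (eqv_of_invE varE_le_basis varE_eqv ⟨hx, fun z s hs => ⟨fun hu => ?_, fun hv => ?_⟩⟩)
    · by_contra hv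
      exact hn (eqv_eDual_of_before hV huv hx hs hu hv)
    · by_contra hu
      exact hn (eqv_eDual_of_before hV huv.symm hx.symm ((hx.lin s).1 hs) hv hu)
  · exact (eqv_comm_of_not_le hV h1).append_right [0]

theorem eqv_e_of_not_le (hV : V ≤ definedBy basisA0Q) (h : ¬ varE.dual ≤ V) :
    V.Eqv [0, 1, 0] [0, 0, 1] := by
  have h1 : ¬ varE ≤ V.dual := fun h' => h (by simpa [dual_dual] using dual_le_dual h')
  exact eqv_dual.1 (eqv_eDual_of_not_le (dual_le_basis hV) h1)

/-- Keep only `r` and `s`. Then `v` becomes a power of `s` times a power of `r`, with value `xxyy`.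
The trace `u'` of `u` contains `rs`, so `s u' r` has the same short subwords as `srsr`, and
comparing their values gives `xyxy = x(xxyy)y = xxyy`. -/
theorem eqv_comm_of_pair (hV : V ≤ definedBy basisA0Q) {u v : List ℕ} (huv : V.Eqv u v)
    {r s : ℕ} (hrs : r ≠ s) (hu : [r, s].Sublist u) (hv : ¬ [r, s].Sublist v)
    (hr : [r, r].Sublist v) (hs : [s, s].Sublist v) : V.Eqv [0, 0, 1, 1] [0, 1, 0, 1] := by
  intro M hM φ
  let ψ : ℕ → M := fun n => if n = r then φ 1 else if n = s then φ 0 else 1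
  have hfilter (l : List ℕ) : ((l.filter fun n => n = r ∨ n = s).map ψ).prod = (l.map ψ).prod := by
    induction l with
    | nil => rfl
    | cons a l ih =>
      by_cases ha : a = r ∨ a = s
      · rw [List.filter_cons_of_pos (by simpa using ha), List.map_cons, List.map_cons,
          List.prod_cons, List.prod_cons, ih]
      · have : ψ a = 1 := by simp only [ψ]; rw [if_neg (by tauto), if_neg (by tauto)]
        rw [List.filter_cons_of_neg (by simpa using ha), List.map_cons, List.prod_cons, this,
          one_mul, ih]
  let u' := u.filter fun n => n = r ∨ n = s
  have hu' : (u'.map ψ).prod = (u.map ψ).prod := hfilter u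
  have hmem (z : ℕ) : z ∈ u' → z = r ∨ z = s := by simp [u']
  have hru : r ∈ u' := by simp [u', mem_left_of_pair hu]
  have hsu : s ∈ u' := by simp [u', mem_right_of_pair hu]
  have hpair : [r, s].Sublist u' := by
    have := hu.filter fun n => n = r ∨ n = s
    simpa [u'] using this
  have hsq (z : ℕ) (hz : z = r ∨ z = s) : [z, z].Sublist (s :: (u' ++ [r])) := by
    simp only [pair_sublist_cons, pair_sublist_append]
    rcases hz with rfl | rfl <;> simp [hru, hsu]
  have hsq' (z : ℕ) (hz : z = r ∨ z = s) : [z, z].Sublist [s, r, s, r] := by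
    simp only [pair_sublist_cons]
    rcases hz with rfl | rfl <;> simp
  have hA : InvA0 (s :: (u' ++ [r])) [s, r, s, r] := by
    refine ⟨fun z => ?_, fun a b => ?_⟩
    · have := hmem z
      simp
      grind
    · have key : (a = r ∨ a = s) → (b = r ∨ b = s) →
          [a, b].Sublist (s :: (u' ++ [r])) ∧ [a, b].Sublist [s, r, s, r] := by
        rintro (rfl | rfl) (rfl | rfl)
        · exact ⟨hsq _ (by simp), hsq' _ (by simp)⟩
        · simp [hpair]
        · simp
        · exact ⟨hsq _ (by simp), hsq' _ (by simp)⟩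
      have hm1 (z : ℕ) (hz : z ∈ s :: (u' ++ [r])) : z = r ∨ z = s := by
        have := hmem z; simp at hz; tauto
      have hm2 (z : ℕ) (hz : z ∈ [s, r, s, r]) : z = r ∨ z = s := by
        simp at hz; tauto
      exact ⟨fun h => (key (hm1 _ (mem_left_of_pair h)) (hm1 _ (mem_right_of_pair h))).2,
        fun h => (key (hm2 _ (mem_left_of_pair h)) (hm2 _ (mem_right_of_pair h))).1⟩
  have hlin (z : ℕ) : ¬ Lin (s :: (u' ++ [r])) z := fun hz => by
    have h1 := hz.mem
    have h2 := hmem z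
    exact not_pair_self_of_lin hz (hsq z (by simp at h1; tauto))
  -- Neither word has a linear letter, so the block condition is vacuous.
  have hE := eqv_of_invQ_invA0 hV ⟨hA.toInvB0, fun s _ _ hs => absurd hs (hlin s)⟩ hA M hM ψ
  obtain ⟨p, q, rfl, hp, hq⟩ := exists_split_of_not_pair hrs hv
  have h1 := huv M hM ψ
  rw [List.map_append, List.prod_append,
    prod_map_eq_pow (w := p) (x := s) fun z hz hzy => by
      simp only [ψ]; rw [if_neg (by rintro rfl; exact hp hz), if_neg hzy],
    prod_map_eq_pow (w := q) (x := r) fun z hz hzx => by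
      simp only [ψ]; rw [if_neg hzx, if_neg (by rintro rfl; exact hq hz)]] at h1
  have e1 : ψ r = φ 1 := if_pos rfl
  have e2 : ψ s = φ 0 := by simp [ψ, hrs.symm]
  have hpow (a : M) {k : ℕ} (hk : 2 ≤ k) : a ^ k = a * a := by
    obtain ⟨k, rfl⟩ := Nat.exists_eq_add_of_le' hk
    rw [pow_succ]
    simpa using pow_mul_pow (hV hM) a 1 (i := k + 1) (j := 1) (by omega) (by omega)
  rw [pair_self_sublist, List.count_append, List.count_eq_zero.2 hp, zero_add] at hr
  rw [pair_self_sublist, List.count_append, List.count_eq_zero.2 hq, add_zero] at hs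
  rw [e1, e2, hpow _ hr, hpow _ hs] at h1
  simp only [List.map_cons, List.map_append, List.map_nil, List.prod_cons, List.prod_append,
    List.prod_nil, mul_one, hu', h1, e1, e2] at hE
  have h3 (a : M) : a * (a * a) = a * a := by
    simpa [mul_assoc] using (mem_basis.1 (hV hM)).1 a 1
  simp only [List.map_cons, List.map_nil, List.prod_cons, List.prod_nil, mul_one]
  rw [← hE, mul_assoc (φ 0 * φ 0), mul_assoc (φ 1), h3, ← mul_assoc (φ 0) (φ 0 * φ 0), h3, mul_assoc]

/-- If `V` contains `E` and its dual, the `B₀` invariant settles every pair with a linear letter, so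
a violated pair consists of distinct nonlinear letters. Otherwise `xyx ≈ xxy` or `xyx ≈ yxx` holds,
and each implies the claim. -/
theorem eqv_q_of_not_le (hV : V ≤ definedBy basisA0Q) (h : ¬ varA0 ≤ V) :
    V.Eqv [0, 0, 1, 1] [0, 1, 0, 1] := by
  by_cases hE : varE ≤ V
  · by_cases hE' : varE.dual ≤ V
    · obtain ⟨u, v, huv, hne⟩ := exists_eqv_of_not_le h
      have h1 : InvB0 u v := ⟨.of_eqv hE huv, (InvEDual.of_eqv hE' huv).after⟩
      by_contra hn
      have key {u v : List ℕ} (huv : V.Eqv u v) (h1 : InvB0 u v) {r s : ℕ}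
          (hu : [r, s].Sublist u) : [r, s].Sublist v := by
        by_contra hv
        have hsq (z : ℕ) (hz : z ∈ u) (hl : ¬ Lin u z) : [z, z].Sublist v := by
          rw [h1.lin, lin_iff] at hl
          have := (h1.mem z).1 hz
          tauto
        have hr : ¬ Lin u r := fun hr => hv ((h1.after s r hr).1 hu)
        have hs : ¬ Lin u s := fun hs => hv ((h1.before r s hs).1 hu)
        have hrs : r ≠ s := by
          rintro rfl
          exact hv (hsq r (mem_left_of_pair hu) hr)
        exact hn (eqv_comm_of_pair hV huv hrs hu hv (hsq r (mem_left_of_pair hu) hr)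
          (hsq s (mem_right_of_pair hu) hs))
      exact hne (eqv_of_invA0 varA0_le_basis varA0_eqv
        ⟨h1.mem, fun r s => ⟨key huv h1, key huv.symm h1.symm⟩⟩)
    · exact comm_of_e (eqv_e_of_not_le hV hE')
  · intro M hM φ
    have := eqv_eDual_of_not_le hV hE M hM fun n => if n = 0 then φ 1 else φ 0
    simp at this ⊢
    rw [this]

theorem eqv_a0_of_not_le (hV : V ≤ definedBy basisA0Q) (h : ¬ varQ ≤ V) :
    V.Eqv [0, 1, 0, 2, 0] [0, 1, 2, 0] := by
  by_cases hE : varE ≤ V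
  · by_cases hE' : varE.dual ≤ V
    · obtain ⟨u, v, huv, hne⟩ := exists_eqv_of_not_le h
      have h1 : InvB0 u v := ⟨.of_eqv hE huv, (InvEDual.of_eqv hE' huv).after⟩
      by_contra hn
      have key {u v : List ℕ} (huv : V.Eqv u v) (h1 : InvB0 u v) {s z t : ℕ} (hs : Lin u s)
          (ht : Lin u t) (hu : [s, z, t].Sublist u) : [s, z, t].Sublist v := by
        by_contra hv
        refine hn fun M hM φ => ?_
        have hs' := (h1.lin s).1 hs
        have ht' := (h1.lin t).1 ht
        obtain ⟨hst, hsz, htz⟩ : s ≠ t ∧ s ≠ z ∧ t ≠ z := by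
          by_contra hc
          exact triple_false_left hs (t := t) (x := z) (by tauto) ht hu
        have hord := pair_of_triple hu
        have hord' := (h1.before s t ht).1 hord
        obtain ⟨p, q, r, rfl⟩ := hs.exists_split_pair ht hord
        obtain ⟨p', q', r', rfl⟩ := hs'.exists_split_pair ht' hord'
        have h2 := huv M hM fun n => if n = z then φ 0 else if n = s then φ 1 else
          if n = t then φ 2 else 1
        rw [prod_map_split_pair hs ht hsz.symm htz.symm,
          prod_map_split_pair hs' ht' hsz.symm htz.symm] at h2
        rw [between_lin hs ht] at hu
        rw [between_lin hs' ht'] at hv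
        rw [List.count_eq_zero.2 hv, pow_zero, mul_one] at h2
        have hq : q.count z ≠ 0 := mt List.count_eq_zero.1 (not_not.2 hu)
        have hW := hV hM
        -- Here `h2` has the form `xⁱyxʲzxᵏ = xˡyzxᵐ` with `j ≥ 1`. Multiplying by `x` on both sides
        -- makes all outer exponents positive, whatever `i`, `k`, `l` and `m` were.
        have h3 := congrArg (fun m => φ 0 * m * φ 0) h2
        have e1 : φ 0 * (φ 0 ^ p.count z * φ 1 * φ 0 ^ q.count z * φ 2 * φ 0 ^ r.count z) * φ 0 =
            φ 0 * φ 1 * φ 0 * φ 2 * φ 0 := by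
          rw [← pow_mul_pow hW (φ 0) (φ 1) (i := p.count z + 1) (Nat.succ_ne_zero _) hq,
            pow_succ']
          have := pow_mul_pow hW (φ 0) (φ 2) (i := q.count z) (j := r.count z + 1) hq
            (Nat.succ_ne_zero _)
          have h5 := pow_mul_pow hW (φ 0) (φ 2) (i := q.count z) (j := 1) hq one_ne_zero
          rw [← h5, pow_succ, pow_one] at this
          simp only [mul_assoc] at this ⊢
          rw [this]
        have e2 : φ 0 * (φ 0 ^ p'.count z * φ 1 * φ 2 * φ 0 ^ r'.count z) * φ 0 =
            φ 0 * (φ 1 * φ 2) * φ 0 := by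
          rw [← pow_mul_pow hW (φ 0) (φ 1 * φ 2) (i := p'.count z + 1) (j := r'.count z + 1)
            (Nat.succ_ne_zero _) (Nat.succ_ne_zero _), pow_succ', pow_succ]
          simp only [mul_assoc]
        simp only [e1, e2] at h3
        simpa [mul_assoc] using h3
      exact hne (eqv_of_invQ_comm varQ_le_basis varQ_eqv
        ⟨h1, fun s z t hs ht => ⟨key huv h1 hs ht,
          key huv.symm h1.symm ((h1.lin s).1 hs) ((h1.lin t).1 ht)⟩⟩)
    · intro M hM φ
      have h1 (a b : M) : a * (b * a) = a * (a * b) := by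
        simpa using eqv_e_of_not_le hV hE' M hM fun n => if n = 0 then a else b
      have h2 : φ 0 * (φ 1 * (φ 0 * φ 0)) = φ 0 * (φ 1 * φ 0) := by
        simpa [mul_assoc] using (mem_basis.1 (hV hM)).2.1 (φ 0) (φ 1)
      have h3 := h1 (φ 0) (φ 1 * φ 2)
      have h4 := congrArg (· * φ 2) h2
      have h5 := congrArg (· * φ 2) (h1 (φ 0) (φ 1))
      simp only [mul_assoc] at h3 h4 h5
      simp [h1 (φ 0) (φ 2), h3, h4, h5]
  · intro M hM φ
    have h1 (a b : M) : a * (b * a) = b * (a * a) := by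
      simpa using eqv_eDual_of_not_le hV hE M hM fun n => if n = 0 then a else b
    have h2 : φ 0 * (φ 0 * (φ 2 * φ 0)) = φ 0 * (φ 2 * φ 0) := by
      simpa [mul_assoc] using (mem_basis.1 (hV hM)).1 (φ 0) (φ 2)
    have h3 := h1 (φ 0) (φ 1 * φ 2)
    have h4 := congrArg (· * (φ 2 * φ 0)) (h1 (φ 0) (φ 1))
    simp only [mul_assoc] at h3 h4
    simp only [List.map_cons, List.map_nil, List.prod_cons, List.prod_nil, mul_one]
    rw [h4, h2, h1 (φ 0) (φ 2), h3]

end Exclusion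

/-! ## The lattice of subvarieties -/

section Inclusions

theorem trivial_le (V : MonoidVariety.{u}) : trivial ≤ V := by
  intro M hM
  have : Subsingleton M := hM
  exact V.image_mem' _ V.punit_mem M (1 : PUnit →* M) fun a => ⟨1, Subsingleton.elim _ _⟩

theorem rqOne_le_rqX : varRees.{u} {1} ≤ varRees {x} :=
  le_iff_eqv.2 fun _ _ h => eqv_of_mem_iff (varRees_le_basis (by decide)) varRees_one_idem
    (InvRqX.of_eqv le_rfl h).mem

theorem rqX_le_rqXY : varRees.{u} {x} ≤ varRees {x * y} :=
  le_iff_eqv.2 fun _ _ h => eqv_of_invRqX (varRees_le_basis (by decide)) varRees_x_comm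
    (InvRqXY.of_eqv le_rfl h).toInvRqX

theorem varRqXY_eqv_of_inv {u v : List ℕ} (h : InvRqXY u v) : varRees.{u} {x * y} |>.Eqv u v :=
  have hd : (x * y).toList.Nodup := by decide
  eqv_of_invRqXY (varRees_le_basis hd) (varRees_eqv_e hd) (varRees_eqv_eDual hd) h

theorem rqXY_le_e : varRees.{u} {x * y} ≤ varE :=
  le_iff_eqv.2 fun _ _ h => varRqXY_eqv_of_inv (InvE.of_eqv le_rfl h).toInvRqXY

theorem rqXY_le_eDual : varRees.{u} {x * y} ≤ varE.dual :=
  le_iff_eqv.2 fun _ _ h => varRqXY_eqv_of_inv (InvEDual.of_eqv le_rfl h).toInvRqXY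

/-- Otherwise `B₀` would satisfy `xyx ≈ yxx`; but `faf = 0`, while `aff = a`. -/
theorem e_le_b0 : varE.{u} ≤ varB0 := by
  by_contra h
  have h1 := eqv_eDual_of_not_le varB0_le_basis h
  rw [varB0, eqv_generatedBy] at h1
  have h2 := models_ulift.1 h1 fun n => if n = 0 then .f else .a
  revert h2
  decide

theorem eDual_le_b0 : varE.{u}.dual ≤ varB0 := by
  by_contra h
  have h1 := eqv_e_of_not_le varB0_le_basis h
  rw [varB0, eqv_generatedBy] at h1
  have h2 := models_ulift.1 h1 fun n => if n = 0 then .e else .a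
  revert h2
  decide

theorem b0_le_a0 : varB0.{u} ≤ varA0 :=
  le_iff_eqv.2 fun _ _ h => eqv_of_invB0 varB0_le_basis varB0_eqv varB0_eqv_comm
    (InvA0.of_eqv le_rfl h).toInvB0

theorem b0_le_q : varB0.{u} ≤ varQ :=
  le_iff_eqv.2 fun _ _ h => eqv_of_invB0 varB0_le_basis varB0_eqv varB0_eqv_comm
    (InvQ.of_eqv le_rfl h).toInvB0

theorem sup_eq_basis : varA0.{u} ⊔ varQ = definedBy basisA0Q :=
  le_antisymm (sup_le varA0_le_basis varQ_le_basis) (le_iff_eqv.2 fun _ _ h =>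
    have h := eqv_sup.1 h
    eqv_of_invQ_invA0 le_rfl (.of_eqv le_rfl h.2) (.of_eqv le_rfl h.1))

theorem varE_dual_eqv : varE.{u}.dual.Eqv [0, 1, 0] [1, 0, 0] := eqv_dual.2 varE_eqv

theorem not_rqOne_le_trivial : ¬ varRees.{u} {1} ≤ trivial := fun h => by
  have h1 : trivial.{u}.Eqv [0] [] := fun M hM φ =>
    have : Subsingleton M := hM
    Subsingleton.elim _ _
  simpa using mem_iff_of_eqv h h1 0

theorem not_rqX_le_rqOne : ¬ varRees.{u} {x} ≤ varRees {1} := fun h => by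
  simpa [Lin] using (InvRqX.of_eqv h varRees_one_idem).lin 0

theorem not_rqXY_le_rqX : ¬ varRees.{u} {x * y} ≤ varRees {x} := fun h =>
  absurd ((InvRqXY.of_eqv h varRees_x_comm).order 0 1 rfl rfl) (by decide)

theorem not_e_le_eDual : ¬ varE.{u} ≤ varE.dual := fun h =>
  absurd ((InvE.of_eqv h varE_dual_eqv).before 0 1 rfl) (by decide)

theorem not_eDual_le_e : ¬ varE.{u}.dual ≤ varE := fun h =>
  not_e_le_eDual (by simpa only [dual_dual] using dual_le_dual h)

theorem not_a0_le_q : ¬ varA0.{u} ≤ varQ := fun h =>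
  absurd ((InvA0.of_eqv h varQ_eqv).pair 1 0) (by decide)

theorem not_q_le_a0 : ¬ varQ.{u} ≤ varA0 := fun h =>
  absurd ((InvQ.of_eqv h varA0_eqv).between 1 0 2 rfl rfl) (by decide)

end Inclusions

/-! ### The order of the diagram -/

namespace Node

/-- The generators of the lattice below a node, as the binary digits of a number. -/
def code : Node → ℕ
  | .zero => 0
  | .rqOne => 1
  | .rqX => 3
  | .rqXY => 7
  | .e => 15
  | .eDual => 23
  -- The union of the digits of `e` and `eDual`, with no digit of its own.
  | .b0 => 31
  | .a0 => 63
  | .q => 95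
  | .a0q => 127

/-- The order of the diagram. -/
def below (m n : Node) : Prop := m.code ||| n.code = n.code

instance (m n : Node) : Decidable (below m n) := inferInstanceAs (Decidable (_ = _))

theorem reflTransGen_of_below (m n : Node) (h : below m n) : Relation.ReflTransGen Edge m n := by
  have h1 (m : Node) (h : below m .zero) : Relation.ReflTransGen Edge m .zero := by
    cases m <;> first | exact .refl | exact absurd h (by decide)
  have h2 (m : Node) (h : below m .rqOne) : Relation.ReflTransGen Edge m .rqOne := by
    cases m <;> first | exact .refl | exact absurd h (by decide) | exact .tail (h1 _ (by decide)) .zero_rqOne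
  have h3 (m : Node) (h : below m .rqX) : Relation.ReflTransGen Edge m .rqX := by
    cases m <;> first | exact .refl | exact absurd h (by decide) | exact .tail (h2 _ (by decide)) .rqOne_rqX
  have h4 (m : Node) (h : below m .rqXY) : Relation.ReflTransGen Edge m .rqXY := by
    cases m <;> first | exact .refl | exact absurd h (by decide) | exact .tail (h3 _ (by decide)) .rqX_rqXY
  have h5 (m : Node) (h : below m .e) : Relation.ReflTransGen Edge m .e := by
    cases m <;> first | exact .refl | exact absurd h (by decide) | exact .tail (h4 _ (by decide)) .rqXY_e
  have h6 (m : Node) (h : below m .eDual) : Relation.ReflTransGen Edge m .eDual := by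
    cases m <;> first | exact .refl | exact absurd h (by decide) | exact .tail (h4 _ (by decide)) .rqXY_eDual
  have h7 (m : Node) (h : below m .b0) : Relation.ReflTransGen Edge m .b0 := by
    cases m <;> first | exact .refl | exact absurd h (by decide) | exact .tail (h5 _ (by decide)) .e_b0 |
      exact .tail (h6 _ (by decide)) .eDual_b0
  have h8 (m : Node) (h : below m .a0) : Relation.ReflTransGen Edge m .a0 := by
    cases m <;> first | exact .refl | exact absurd h (by decide) | exact .tail (h7 _ (by decide)) .b0_a0
  have h9 (m : Node) (h : below m .q) : Relation.ReflTransGen Edge m .q := by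
    cases m <;> first | exact .refl | exact absurd h (by decide) | exact .tail (h7 _ (by decide)) .b0_q
  cases n
  · exact h1 m h
  · exact h2 m h
  · exact h3 m h
  · exact h4 m h
  · exact h5 m h
  · exact h6 m h
  · exact h7 m h
  · exact h8 m h
  · exact h9 m h
  · cases m <;> first | exact .refl | exact .tail (h8 _ (by decide)) .a0_a0q |
      exact .tail (h9 _ (by decide)) .q_a0q

theorem Edge.variety_le {m n : Node} (h : Edge m n) : m.variety ≤ (n.variety : MonoidVariety.{u}) := by
  cases h
  exacts [trivial_le _, rqOne_le_rqX, rqX_le_rqXY, rqXY_le_e, rqXY_le_eDual, e_le_b0, eDual_le_b0,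
    b0_le_a0, b0_le_q, le_sup_left, le_sup_right]

theorem variety_le {m n : Node} (h : Relation.ReflTransGen Edge m n) :
    m.variety ≤ (n.variety : MonoidVariety.{u}) := by
  induction h with
  | refl => exact le_rfl
  | tail _ h ih => exact ih.trans h.variety_le

/-- Every missing inclusion between nodes would imply one of seven critical ones, so only these need
to be refuted. -/
theorem below_or (m n : Node) : below m n ∨ (below .rqOne m ∧ below n .zero) ∨
    (below .rqX m ∧ below n .rqOne) ∨ (below .rqXY m ∧ below n .rqX) ∨
    (below .e m ∧ below n .eDual) ∨ (below .eDual m ∧ below n .e) ∨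
    (below .a0 m ∧ below n .q) ∨ (below .q m ∧ below n .a0) := by
  cases m <;> cases n <;> decide

theorem below_of_variety_le {m n : Node} (h : m.variety ≤ (n.variety : MonoidVariety.{u})) :
    below m n := by
  have key {j k : Node} (hjm : below j m) (hnk : below n k) :
      j.variety ≤ (k.variety : MonoidVariety.{u}) :=
    (variety_le (reflTransGen_of_below _ _ hjm)).trans
      (h.trans (variety_le (reflTransGen_of_below _ _ hnk)))
  rcases below_or m n with h | h | h | h | h | h | h | h
  · exact h
  · exact absurd (key h.1 h.2) not_rqOne_le_trivial
  · exact absurd (key h.1 h.2) not_rqX_le_rqOne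
  · exact absurd (key h.1 h.2) not_rqXY_le_rqX
  · exact absurd (key h.1 h.2) not_e_le_eDual
  · exact absurd (key h.1 h.2) not_eDual_le_e
  · exact absurd (key h.1 h.2) not_a0_le_q
  · exact absurd (key h.1 h.2) not_q_le_a0

theorem variety_le_iff {m n : Node} :
    m.variety ≤ (n.variety : MonoidVariety.{u}) ↔ Relation.ReflTransGen Edge m n :=
  ⟨fun h => reflTransGen_of_below _ _ (below_of_variety_le h), variety_le⟩

theorem below_antisymm {m n : Node} (h : below m n) (h' : below n m) : m = n := by
  have hc : m.code = n.code := h'.symm.trans ((Nat.lor_comm _ _).trans h)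
  revert hc
  cases m <;> cases n <;> simp [code]

theorem variety_injective : Function.Injective Node.variety.{u} := fun _ _ h =>
  below_antisymm (below_of_variety_le h.le) (below_of_variety_le h.ge)

theorem finite : Finite Node := by
  refine Finite.of_injective (β := Fin 128) (fun n => ⟨n.code, by cases n <;> decide⟩) fun m n h => ?_
  have hc : m.code = n.code := congrArg Fin.val h
  revert hc
  cases m <;> cases n <;> simp [code]

end Node

/-! ### Classification of subvarieties, the Cross property and the maximal subvarieties -/

theorem exists_node {V : MonoidVariety.{u}} (hV : V ≤ varA0 ⊔ varQ) : ∃ n : Node, V = n.variety := by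
  have hW := hV.trans sup_eq_basis.le
  have leB0 (ha : V.Eqv [0, 1, 0, 2, 0] [0, 1, 2, 0]) (hq : V.Eqv [0, 0, 1, 1] [0, 1, 0, 1])
      (he : varE ≤ V) (hd : varE.dual ≤ V) : ∃ n : Node, V = n.variety := by
    refine ⟨.b0, le_antisymm ?_ ?_⟩
    · refine le_iff_eqv.2 fun u v h => eqv_of_invB0 hW ha hq ⟨.of_eqv e_le_b0 h, ?_⟩
      exact (InvEDual.of_eqv eDual_le_b0 h).after
    · refine le_iff_eqv.2 fun u v h => eqv_of_invB0 varB0_le_basis varB0_eqv varB0_eqv_comm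
        ⟨.of_eqv he h, (InvEDual.of_eqv hd h).after⟩
  -- Generators are tested from the top down. The omitted ones supply the identities that make an
  -- invariant complete for `V`, which bounds `V` from above; the contained ones bound it from
  -- below.
  by_cases hA : varA0 ≤ V
  · by_cases hQ : varQ ≤ V
    · exact ⟨.a0q, le_antisymm hV (sup_le hA hQ)⟩
    · refine ⟨.a0, le_antisymm (le_iff_eqv.2 fun u v h => ?_) hA⟩
      exact eqv_of_invA0 hW (eqv_a0_of_not_le hW hQ) (.of_eqv le_rfl h)
  by_cases hQ : varQ ≤ V
  · refine ⟨.q, le_antisymm (le_iff_eqv.2 fun u v h => ?_) hQ⟩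
    exact eqv_of_invQ_comm hW (eqv_q_of_not_le hW hA) (.of_eqv le_rfl h)
  by_cases hE : varE ≤ V
  · by_cases hD : varE.dual ≤ V
    · exact leB0 (eqv_a0_of_not_le hW hQ) (eqv_q_of_not_le hW hA) hE hD
    · refine ⟨.e, le_antisymm (le_iff_eqv.2 fun u v h => ?_) hE⟩
      exact eqv_of_invE hW (eqv_e_of_not_le hW hD) (.of_eqv le_rfl h)
  by_cases hD : varE.dual ≤ V
  · refine ⟨.eDual, le_antisymm (le_iff_eqv.2 fun u v h => ?_) hD⟩
    exact eqv_of_invEDual hW (eqv_eDual_of_not_le hW hE) (.of_eqv le_rfl h)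
  by_cases h3 : varRees {x * y} ≤ V
  · refine ⟨.rqXY, le_antisymm (le_iff_eqv.2 fun u v h => ?_) h3⟩
    exact eqv_of_invRqXY hW (eqv_e_of_not_le hW hD) (eqv_eDual_of_not_le hW hE) (.of_eqv le_rfl h)
  by_cases h2 : varRees {x} ≤ V
  · refine ⟨.rqX, le_antisymm (le_iff_eqv.2 fun u v h => ?_) h2⟩
    exact eqv_of_invRqX hW (eqv_comm_of_not_le hW h3) (.of_eqv le_rfl h)
  by_cases h1 : varRees {1} ≤ V
  · refine ⟨.rqOne, le_antisymm (le_iff_eqv.2 fun u v h => ?_) h1⟩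
    exact eqv_of_mem_iff hW (eqv_idem_of_not_le hW h2) (mem_iff_of_eqv le_rfl h)
  exact ⟨.zero, le_antisymm (le_trivial (eqv_nil_of_not_le hW h1)) (trivial_le _)⟩

theorem le_sup_iff {V : MonoidVariety.{u}} : V ≤ varA0 ⊔ varQ ↔ ∃ n : Node, V = n.variety := by
  refine ⟨exists_node, ?_⟩
  rintro ⟨n, rfl⟩
  exact Node.variety_le (n := .a0q) (Node.reflTransGen_of_below _ _ (by cases n <;> decide))

theorem models_prod {M N : Type*} [Monoid M] [Monoid N] {u v : List ℕ} (hM : Models M u v)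
    (hN : Models N u v) : Models (M × N) u v := by
  intro φ
  have h1 (w : List ℕ) : (w.map φ).prod = ((w.map fun n => (φ n).1).prod, (w.map fun n => (φ n).2).prod) := by
    induction w with
    | nil => rfl
    | cons a w ih => simp only [List.map_cons, List.prod_cons, ih]; rfl
  rw [h1, h1, hM, hN]

/-- The identities of a direct product are those common to both factors, so the join is generated by
the finite monoid `MonA0 × MonQ`. -/
theorem sup_eq_generatedBy :
    varA0.{u} ⊔ varQ = generatedBy (MonCat.of (ULift.{u} (MonA0 × MonQ))) := by
  refine le_antisymm (sup_le ?_ ?_) ?_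
  · refine le_iff_eqv.2 fun u v h => eqv_generatedBy.2 (models_ulift.2 ?_)
    exact (models_ulift.1 (eqv_generatedBy.1 h)).of_surjective (MonoidHom.fst _ _) Prod.fst_surjective
  · refine le_iff_eqv.2 fun u v h => eqv_generatedBy.2 (models_ulift.2 ?_)
    exact (models_ulift.1 (eqv_generatedBy.1 h)).of_surjective (MonoidHom.snd _ _) Prod.snd_surjective
  · refine le_iff_eqv.2 fun u v h => eqv_generatedBy.2 (models_ulift.2 ?_)
    have h := eqv_sup.1 h
    exact models_prod (models_of_generatedBy_le le_rfl h.1) (models_of_generatedBy_le le_rfl h.2)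

theorem isCross_sup : (varA0.{u} ⊔ varQ).IsCross := by
  refine ⟨⟨basisA0Q, ?_, sup_eq_basis⟩, ⟨_, ?_, sup_eq_generatedBy⟩, ?_⟩
  · simp [basisA0Q]
  · exact inferInstanceAs (Finite (ULift (MonA0 × MonQ)))
  · have := Node.finite
    refine (Set.finite_range Node.variety.{u}).subset fun V hV => ?_
    obtain ⟨n, rfl⟩ := exists_node hV
    exact ⟨n, rfl⟩

theorem covBy_sup_iff {V : MonoidVariety.{u}} : V ⋖ varA0 ⊔ varQ ↔ V = varA0 ∨ V = varQ := by
  have hA : varA0.{u} < varA0 ⊔ varQ := lt_of_le_of_ne le_sup_left fun h =>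
    not_q_le_a0 (h ▸ le_sup_right)
  have hQ : varQ.{u} < varA0 ⊔ varQ := lt_of_le_of_ne le_sup_right fun h =>
    not_a0_le_q (h ▸ le_sup_left)
  have key {V : MonoidVariety.{u}} (h : V < varA0 ⊔ varQ) : V ≤ varA0 ∨ V ≤ varQ := by
    obtain ⟨n, rfl⟩ := exists_node h.le
    have h1 : n ≠ .a0q := by rintro rfl; exact lt_irrefl _ h
    have h2 : Node.below n .a0 ∨ Node.below n .q := by
      cases n <;> first | decide | exact absurd rfl h1
    exact h2.imp (fun h => Node.variety_le (n := .a0) (Node.reflTransGen_of_below _ _ h))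
      fun h => Node.variety_le (n := .q) (Node.reflTransGen_of_below _ _ h)
  constructor
  · intro h
    rcases key h.lt with h1 | h1
    · exact Or.inl (h1.eq_of_not_lt fun h2 => h.2 h2 hA)
    · exact Or.inr (h1.eq_of_not_lt fun h2 => h.2 h2 hQ)
  · rintro (rfl | rfl)
    · refine ⟨hA, fun U hU hU' => ?_⟩
      rcases key hU' with h1 | h1
      · exact hU.not_ge h1
      · exact not_a0_le_q (hU.le.trans h1)
    · refine ⟨hQ, fun U hU hU' => ?_⟩
      rcases key hU' with h1 | h1
      · exact not_q_le_a0 (hU.le.trans h1)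
      · exact hU.not_ge h1

end MonoidVariety

theorem mainTheorem4 :
    -- the variety is Cross
    MonoidVariety.IsCross.{u} (MonoidVariety.varA0 ⊔ MonoidVariety.varQ) ∧
    -- an explicit basis of identities
    (MonoidVariety.varA0 ⊔ MonoidVariety.varQ : MonoidVariety.{u}) =
      MonoidVariety.definedBy MonoidVariety.basisA0Q ∧
    -- the maximal subvarieties
    (∀ V : MonoidVariety.{u}, V ⋖ MonoidVariety.varA0 ⊔ MonoidVariety.varQ ↔
      V = MonoidVariety.varA0 ∨ V = MonoidVariety.varQ) ∧
    (MonoidVariety.varA0 : MonoidVariety.{u}) ≠ MonoidVariety.varQ ∧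
    -- the lattice of subvarieties: its elements, that they are distinct, and its order
    (∀ V : MonoidVariety.{u}, V ≤ MonoidVariety.varA0 ⊔ MonoidVariety.varQ ↔
      ∃ n : MonoidVariety.Node, V = n.variety) ∧
    Function.Injective MonoidVariety.Node.variety.{u} ∧
    (∀ m n : MonoidVariety.Node, (m.variety : MonoidVariety.{u}) ≤ n.variety ↔
      Relation.ReflTransGen MonoidVariety.Node.Edge m n) :=
  ⟨MonoidVariety.isCross_sup, MonoidVariety.sup_eq_basis, fun _ => MonoidVariety.covBy_sup_iff,
    fun h => MonoidVariety.not_a0_le_q h.le, fun _ => MonoidVariety.le_sup_iff,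
    MonoidVariety.Node.variety_injective, fun _ _ => MonoidVariety.Node.variety_le_iff⟩
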